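/- Let $M\ge 0$, $T>0$, and let $D_0\subseteq\mathbb R^3$ be open. Put $$L_{KGdS}:=\partial_t^2-e^{-2t}\Delta-M^2,$$ where $\Delta$ is the Laplacian in $x\in\mathbb R^3$. For $(x_0,t_0)\in\mathbb R^{3}\times\mathbb R$ let $$D^{dS}_-(x_0,t_0):=\{(x,t)\in\mathbb R^3\times\mathbb R:\ |x-x_0|\le -(e^{-t_0}-e^{-t})\},$$ and define the de Sitter domain of dependence of $D_0$ by $$D^{dS}(D_0):=\bigcup\bigl\{D^{dS}_-(x_0,t_0):\ x_0\in\mathbb R^3,\ t_0\ge 0,\ D^{dS}_-(x_0,t_0)\cap\{t=0\}\subseteq D_0\bigr\}.$$ A function of class $C^2$ on an open set is called superharmonic if its Laplacian is $\le 0$ there. Let $u=u(x,t)$ be a real function of class $C^2$ on $D^{dS}(D_0)\cap\{0\le t\le T\}$ (time derivatives at $t=0$ and $t=T$ are one-sided). Assume that on this set $L_{KGdS}[u]\le 0$, $L_{KGdS}[u]$ is of class $C^2$, and, for each $t\in[0,T]$, $L_{KGdS}[u](\cdot,t)$ is superharmonic in $x$. Assume that $u(\cdot,0)$ and $u_t(\cdot,0)$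 are of class $C^2$, superharmonic and non-positive in $D_0$. (i) If $M>1$, then for all $(x,t)\in D^{dS}(D_0)$ with $t\in[\ln(M/(M-1)),T]$, $$u(x,t)\le\int_0^t L_{KGdS}[u](x,b)\,\frac1M\sinh(M(t-b))\,db+\cosh(Mt)\,u(x,0)+\frac1M\sinh(Mt)\,u_t(x,0), \qquad (*)$$ and in particular $u(x,t)\le 0$. (ii) If $u(x,0)=0$ for all $x\in D_0$, then, for every $M\ge 0$, both $(*)$ and $u(x,t)\le 0$ hold for all $(x,t)\in D^{dS}(D_0)$ with $t\in[0,T]$; for $M=0$ the expression $\frac1M\sinh(Ms)$ in $(*)$ is understood as its limit $s$. -/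

import Mathlib

open Set

open scoped Laplacian

noncomputable section

namespace DeSitter

/-- The backward light cone `|x - x₀| ≤ -(e^{-t₀} - e^{-t})` of the de Sitter space-time with
apex `(x₀, t₀)`. -/
def backwardCone {n : ℕ} (x₀ : EuclideanSpace ℝ (Fin n)) (t₀ : ℝ) :
    Set (EuclideanSpace ℝ (Fin n) × ℝ) :=
  {p | ‖p.1 - x₀‖ ≤ -(Real.exp (-t₀) - Real.exp (-p.2))}

/-- The de Sitter domain of dependence of `D₀`: the union of all backward cones with apex at a
time `t₀ ≥ 0` whose intersection with the hyperplane `t = 0` lies in `D₀`. -/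
def dependenceDomain {n : ℕ} (D₀ : Set (EuclideanSpace ℝ (Fin n))) :
    Set (EuclideanSpace ℝ (Fin n) × ℝ) :=
  {p | ∃ (x₀ : EuclideanSpace ℝ (Fin n)) (t₀ : ℝ), 0 ≤ t₀ ∧
    (∀ x, (x, (0 : ℝ)) ∈ backwardCone x₀ t₀ → x ∈ D₀) ∧ p ∈ backwardCone x₀ t₀}

/-- The part `0 ≤ t ≤ T` of the domain of dependence of `D₀`. -/
def dependenceSlab {n : ℕ} (D₀ : Set (EuclideanSpace ℝ (Fin n))) (T : ℝ) :
    Set (EuclideanSpace ℝ (Fin n) × ℝ) :=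
  {p | p ∈ dependenceDomain D₀ ∧ p.2 ∈ Icc 0 T}

/-- `φ` is of class `C²` and superharmonic on the (open) set `U`. -/
def SuperharmonicOn {n : ℕ} (φ : EuclideanSpace ℝ (Fin n) → ℝ)
    (U : Set (EuclideanSpace ℝ (Fin n))) : Prop :=
  ContDiffOn ℝ 2 φ U ∧ ∀ x ∈ U, (Δ φ) x ≤ 0

/-- The operator `∂ₜ² - e^{-2t} Δ - M²` on functions on the time interval `[0, T]`; the time
derivatives are one-sided at `t = 0` and at `t = T`. -/
def kleinGordon {n : ℕ} (M T : ℝ) (u : EuclideanSpace ℝ (Fin n) × ℝ → ℝ)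
    (p : EuclideanSpace ℝ (Fin n) × ℝ) : ℝ :=
  iteratedDerivWithin 2 (fun s => u (p.1, s)) (Icc 0 T) p.2
    - Real.exp (-2 * p.2) * (Δ (fun y => u (y, p.2))) p.1 - M ^ 2 * u p

/-- The initial velocity `uₜ(x, 0)` of a function on the time interval `[0, T]`. -/
def initialVelocity {n : ℕ} (T : ℝ) (u : EuclideanSpace ℝ (Fin n) × ℝ → ℝ)
    (x : EuclideanSpace ℝ (Fin n)) : ℝ :=
  derivWithin (fun s => u (x, s)) (Icc 0 T) 0

/-- `(1 / M) sinh (M s)`, read as its limit `s` when `M = 0`. -/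
def sinhOver (M s : ℝ) : ℝ :=
  if M = 0 then s else 1 / M * Real.sinh (M * s)

/-- The right-hand side
`∫₀ᵗ L[u](x,b) (1/M) sinh(M(t-b)) db + cosh(Mt) u(x,0) + (1/M) sinh(Mt) uₜ(x,0)`. -/
def duhamelBound {n : ℕ} (M T : ℝ) (u : EuclideanSpace ℝ (Fin n) × ℝ → ℝ)
    (x : EuclideanSpace ℝ (Fin n)) (t : ℝ) : ℝ :=
  (∫ b in (0 : ℝ)..t, kleinGordon M T u (x, b) * sinhOver M (t - b))
    + Real.cosh (M * t) * u (x, 0) + sinhOver M t * initialVelocity T u x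

end DeSitter

end

open MeasureTheory Metric Filter Topology

/-! Fix a point `x` and let U(r,t) be r times the mean of u(·,t) over the sphere of radius r about
`x`. By Darboux's identity in dimension three, U solves the one-dimensional equation U_tt - e^{-2t}
U_rr - M² U = r · mean of L[u]. The right-hand side of the bound is the solution Q of Q'' = M² Q +
L[u](x,·) with data u(x,0), u_t(x,0). So W = U - rQ is odd in r, and its source G is nonincreasing
in r with G(0,t) = 0, because L[u](·,t) is superharmonic (`radialMean_sub_le`). Since W/r tends to
u(x,t) - Q(t) as r → 0+, it is enough to show W ≤ 0 for small r > 0.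

This sign comes from a maximum principle for cooperative transport systems (`cooperative_nonpos`)
applied to W and its characteristic derivatives. With initial position present, the half-line r ≥ 0
is used with the unknowns W and W_t + e^{-t} W_r - W/2; the coupling coefficient is M² - 1/4, so the
system is cooperative for M ≥ 1/2 (`nonpos_of_half_line`). This yields the bound at all times in
[0,T], in particular on the interval of part (i). With zero initial position, the unknowns are Z and
Z_t ± e^{-t} Z_r on the whole line, which form a cooperative system for every M
(`nonpos_of_whole_line`). They are applied to Z(r,t) = W(r+h,t) - W(r-h,t), whose source and initial
velocity are nonpositive by monotonicity in r; at r = 0 oddness gives Z = 2W(h,t).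

Finally Q ≤ 0, since its data, its source and the kernels have definite signs. -/

/-! ### Maximum principle for cooperative transport systems -/

/-- Maximum principle for cooperative systems of transport equations: if at every point of the
compact set `K` where the component `v i` is positive and the largest one, `v i` can be followed
backwards in time within `K` along a curve on which it grows at a rate at most `C * v i`, then all
components are non-positive. -/
theorem cooperative_nonpos {ι : Type*} [Finite ι] {K : Set (ℝ × ℝ)} (hK : IsCompact K)
    (v : ι → ℝ × ℝ → ℝ) (hv : ∀ i, ContinuousOn (v i) K) (C : ℝ)
    (h : ∀ i, ∀ P ∈ K, 0 < v i P → (∀ j, v j P ≤ v i P) → ∃ (γ : ℝ → ℝ × ℝ) (D : ℝ),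
      γ 0 = P ∧ (∀ᶠ τ in 𝓝[>] (0 : ℝ), γ τ ∈ K) ∧ (∀ τ, (γ τ).2 = P.2 - τ) ∧
        HasDerivAt (fun τ => v i (γ τ)) (-D) 0 ∧ D ≤ C * v i P) :
    ∀ i, ∀ P ∈ K, v i P ≤ 0 := by
  intro i₀ P₀ hP₀
  -- The weight decays faster than the growth rate `C` allows, so a positive maximum of the weighted
  -- components over `K` and over the index is impossible. The weight is the same for all
  -- components, so the maximising component is also the largest unweighted one at that point.
  set Ψ : ι → ℝ × ℝ → ℝ := fun i P => v i P * Real.exp (-(C + 1) * P.2) with hΨ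
  have hΨc : ∀ i, ContinuousOn (Ψ i) K := fun i =>
    (hv i).mul (by fun_prop : Continuous fun P : ℝ × ℝ => Real.exp (-(C + 1) * P.2)).continuousOn
  have hmax : ∀ i, ∃ P ∈ K, ∀ P' ∈ K, Ψ i P' ≤ Ψ i P := fun i =>
    hK.exists_isMaxOn ⟨P₀, hP₀⟩ (hΨc i)
  choose P hPK hPmax using hmax
  have : Nonempty ι := ⟨i₀⟩
  obtain ⟨i, hi⟩ := Finite.exists_max fun i => Ψ i (P i)
  have hall : ∀ j, ∀ P' ∈ K, Ψ j P' ≤ Ψ i (P i) := fun j P' hP' =>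
    (hPmax j P' hP').trans (hi j)
  by_contra! hpos
  have hΨpos : 0 < Ψ i (P i) :=
    (mul_pos hpos (Real.exp_pos _)).trans_le (hall i₀ P₀ hP₀)
  have hvpos : 0 < v i (P i) := pos_of_mul_pos_left hΨpos (Real.exp_pos _).le
  obtain ⟨γ, D, hγ0, hγK, hγ2, hγd, hD⟩ := h i (P i) (hPK i) hvpos fun j =>
    le_of_mul_le_mul_right (hall j (P i) (hPK i)) (Real.exp_pos _)
  have hexp : HasDerivAt (fun τ : ℝ => Real.exp (-(C + 1) * ((P i).2 - τ)))
      (Real.exp (-(C + 1) * ((P i).2 - 0)) * (-(C + 1) * (0 - 1))) 0 :=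
    (((hasDerivAt_const _ _).sub (hasDerivAt_id' (0 : ℝ))).const_mul (-(C + 1))).exp
  have hd := hγd.mul hexp
  -- Moving back along `γ` cannot increase the weighted component above its maximum, so the
  -- right-hand difference quotients at 0 are nonpositive. This forces (C + 1) v ≤ D, against D ≤ C
  -- v and v > 0.
  have hle : -D * Real.exp (-(C + 1) * ((P i).2 - 0)) + v i (γ 0) *
      (Real.exp (-(C + 1) * ((P i).2 - 0)) * (-(C + 1) * (0 - 1))) ≤ 0 := by
    have hslope := (hasDerivWithinAt_iff_tendsto_slope' (self_notMem_Ioi)).1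
      (hd.hasDerivWithinAt (s := Ioi 0))
    refine le_of_tendsto hslope ?_
    filter_upwards [hγK, self_mem_nhdsWithin] with τ hτ hτ0
    have h1 := hall i _ hτ
    simp only [hΨ, hγ2] at h1
    rw [slope_def_field]
    refine div_nonpos_of_nonpos_of_nonneg ?_ (by simpa using hτ0.le)
    simp only [Pi.mul_apply, hγ0, sub_zero]
    linarith
  rw [hγ0] at hle
  have he := Real.exp_pos (-(C + 1) * ((P i).2 - 0))
  have : Real.exp (-(C + 1) * ((P i).2 - 0)) * ((C + 1) * v i (P i) - D) ≤ 0 := by linarith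
  have := nonpos_of_mul_nonpos_right this he
  linarith

/-! ### The one-dimensional wave equation: characteristics and comparison -/

/-- `W`, with space-time derivative `W'`, solves `W_tt - e^{-2t} W_rr - M² W = G` at the points
`(r, t)` of `Ω` with `t > 0`, and is of class `C¹` up to `t = 0`. -/
structure IsWaveSolution (M : ℝ) (Ω : Set (ℝ × ℝ)) (W : ℝ × ℝ → ℝ)
    (W' : ℝ × ℝ → ℝ × ℝ →L[ℝ] ℝ) (G : ℝ × ℝ → ℝ) : Prop where
  continuousOn : ContinuousOn W Ω
  continuousOn_deriv : ContinuousOn W' Ω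
  hasFDerivAt : ∀ v ∈ Ω, 0 < v.2 → HasFDerivAt W (W' v) v
  wave : ∀ v ∈ Ω, 0 < v.2 → ∃ B : ℝ × ℝ →L[ℝ] ℝ × ℝ →L[ℝ] ℝ, HasFDerivAt W' B v ∧
    B (1, 0) (0, 1) = B (0, 1) (1, 0) ∧
    B (0, 1) (0, 1) - Real.exp (-2 * v.2) * B (1, 0) (1, 0) - M ^ 2 * W v = G v

namespace IsWaveSolution

variable {M : ℝ} {Ω Ω₁ Ω₂ : Set (ℝ × ℝ)} {W W₁ W₂ : ℝ × ℝ → ℝ}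
  {W' W₁' W₂' : ℝ × ℝ → ℝ × ℝ →L[ℝ] ℝ} {G G₁ G₂ : ℝ × ℝ → ℝ}

theorem mono (h : IsWaveSolution M Ω₁ W W' G) (hΩ : Ω ⊆ Ω₁) : IsWaveSolution M Ω W W' G where
  continuousOn := h.continuousOn.mono hΩ
  continuousOn_deriv := h.continuousOn_deriv.mono hΩ
  hasFDerivAt v hv := h.hasFDerivAt v (hΩ hv)
  wave v hv := h.wave v (hΩ hv)

theorem sub (h₁ : IsWaveSolution M Ω W₁ W₁' G₁) (h₂ : IsWaveSolution M Ω W₂ W₂' G₂) :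
    IsWaveSolution M Ω (fun v => W₁ v - W₂ v) (fun v => W₁' v - W₂' v)
      (fun v => G₁ v - G₂ v) where
  continuousOn := h₁.continuousOn.sub h₂.continuousOn
  continuousOn_deriv := h₁.continuousOn_deriv.sub h₂.continuousOn_deriv
  hasFDerivAt v hv hv0 := (h₁.hasFDerivAt v hv hv0).sub (h₂.hasFDerivAt v hv hv0)
  wave v hv hv0 := by
    obtain ⟨B₁, hB₁, hs₁, hp₁⟩ := h₁.wave v hv hv0
    obtain ⟨B₂, hB₂, hs₂, hp₂⟩ := h₂.wave v hv hv0
    refine ⟨B₁ - B₂, hB₁.sub hB₂, ?_, ?_⟩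
    · simp [hs₁, hs₂]
    · rw [← hp₁, ← hp₂]
      simp only [_root_.sub_apply]
      ring

theorem translate (h : IsWaveSolution M Ω₁ W W' G) (k : ℝ)
    (hΩ : ∀ v ∈ Ω, v + (k, 0) ∈ Ω₁) :
    IsWaveSolution M Ω (fun v => W (v + (k, 0))) (fun v => W' (v + (k, 0)))
      (fun v => G (v + (k, 0))) where
  continuousOn := h.continuousOn.comp (by fun_prop) hΩ
  continuousOn_deriv := h.continuousOn_deriv.comp (by fun_prop) hΩ
  hasFDerivAt v hv hv0 := by
    exact (hasFDerivAt_comp_add_right _).2 (h.hasFDerivAt _ (hΩ v hv) (by simpa using hv0))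
  wave v hv hv0 := by
    obtain ⟨B, hB, hs, hp⟩ := h.wave _ (hΩ v hv) (by simpa using hv0)
    refine ⟨B, (hasFDerivAt_comp_add_right _).2 hB, hs, ?_⟩
    simpa using hp

/-- The curves keep r - c e^{-t} constant and are parametrised by elapsed backward time. The values
c = ±1 give the two null families, c = 0 the vertical lines. -/
theorem hasDerivAt_characteristic (r t c : ℝ) :
    HasDerivAt (fun τ : ℝ => (r + c * (Real.exp (-(t - τ)) - Real.exp (-t)), t - τ))
      (c * Real.exp (-t), -1) 0 := by
  have h2 : HasDerivAt (fun τ : ℝ => t - τ) (-1) 0 := by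
    simpa using (hasDerivAt_id' (0 : ℝ)).const_sub t
  have h1 : HasDerivAt (fun τ : ℝ => r + c * (Real.exp (-(t - τ)) - Real.exp (-t)))
      (c * Real.exp (-t)) 0 := by
    simpa using ((h2.neg.exp.sub_const (Real.exp (-t))).const_mul c).const_add r
  exact h1.prodMk h2

theorem clm_pair_apply (L : ℝ × ℝ →L[ℝ] ℝ) (a b : ℝ) : L (a, b) = a * L (1, 0) + b * L (0, 1) := by
  have : ((a, b) : ℝ × ℝ) = a • (1, 0) + b • (0, 1) := by simp
  rw [this, map_add, map_smul, map_smul, smul_eq_mul, smul_eq_mul]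

/-- The derivative of a solution along a curve `t ↦ (r - c e^{-t}, t)`, traversed backwards. -/
theorem hasDerivAt_comp_curve (h : IsWaveSolution M Ω W W' G) {r t : ℝ} (hv : (r, t) ∈ Ω)
    (ht : 0 < t) (c : ℝ) :
    HasDerivAt (fun τ : ℝ => W (r + c * (Real.exp (-(t - τ)) - Real.exp (-t)), t - τ))
      (-(W' (r, t) (0, 1) - c * (Real.exp (-t) * W' (r, t) (1, 0)))) 0 := by
  have h1 := h.hasFDerivAt (r, t) hv ht
  have h2 := hasDerivAt_characteristic r t c
  have h3 := HasFDerivAt.comp_hasDerivAt_of_eq (0 : ℝ) h1 h2 (by simp)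
  rw [clm_pair_apply] at h3
  refine h3.congr_deriv ?_
  ring

/-- The derivative of the characteristic derivative `W_t + b e^{-t} W_r` of a solution along
the characteristic of the other family, traversed backwards. -/
theorem hasDerivAt_characteristicDeriv (h : IsWaveSolution M Ω W W' G) {r t : ℝ}
    (hv : (r, t) ∈ Ω) (ht : 0 < t) {b : ℝ} (hb : b ^ 2 = 1) :
    HasDerivAt (fun τ : ℝ => W' (r + b * (Real.exp (-(t - τ)) - Real.exp (-t)), t - τ)
        (b * Real.exp (-(t - τ)), 1))
      (-(M ^ 2 * W (r, t) + G (r, t) - b * (Real.exp (-t) * W' (r, t) (1, 0)))) 0 := by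
  obtain ⟨B, hB, hs, hp⟩ := h.wave (r, t) hv ht
  have h2 := hasDerivAt_characteristic r t b
  have h3 := HasFDerivAt.comp_hasDerivAt_of_eq (0 : ℝ) hB h2 (by simp)
  have h4 : HasDerivAt (fun τ : ℝ => ((b * Real.exp (-(t - τ)), 1) : ℝ × ℝ))
      (b * Real.exp (-t), 0) 0 := by
    have h5 : HasDerivAt (fun τ : ℝ => t - τ) (-1) 0 := by
      simpa using (hasDerivAt_id' (0 : ℝ)).const_sub t
    have h6 : HasDerivAt (fun τ : ℝ => b * Real.exp (-(t - τ))) (b * Real.exp (-t)) 0 := by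
      simpa using h5.neg.exp.const_mul b
    exact h6.prodMk (hasDerivAt_const _ _)
  have h7 := h3.clm_apply h4
  have hexp : Real.exp (-2 * t) = Real.exp (-t) ^ 2 := by
    rw [← Real.exp_nat_mul]; congr 1; push_cast; ring
  have hB1 : B (b * Real.exp (-t), -1) = (b * Real.exp (-t)) • B (1, 0) - B (0, 1) := by
    rw [← map_smul, ← map_sub]; simp
  refine h7.congr_deriv ?_
  simp only [Function.comp_apply, sub_zero, sub_self, mul_zero, add_zero, hB1]
  simp only [_root_.sub_apply, _root_.smul_apply, smul_eq_mul]
  rw [clm_pair_apply (B (1, 0)), clm_pair_apply (B (0, 1)), clm_pair_apply (W' (r, t)), ← hs]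
  simp only [hexp] at hp
  -- Mixed derivatives cancel by symmetry, and b² = 1 turns the remaining second derivatives into
  -- the wave operator; the term with b e^{-t} W_r comes from differentiating the coefficient
  -- e^{-t}.
  linear_combination (-1 : ℝ) * hp + B (1, 0) (1, 0) * Real.exp (-t) ^ 2 * hb

/-- Comparison on the half-line `r ≥ 0` with Dirichlet condition at `r = 0`, for `M ≥ 1 / 2`. -/
theorem nonpos_of_half_line (hM : 1 / 2 ≤ M) {t₁ δ : ℝ}
    (h : IsWaveSolution M {v | v.2 ∈ Icc 0 t₁ ∧ v.1 ∈ Icc 0 (Real.exp (-v.2) - Real.exp (-t₁) + δ)}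
      W W' G)
    (hG : ∀ r t, t ∈ Ioc 0 t₁ → r ∈ Icc 0 (Real.exp (-t) - Real.exp (-t₁) + δ) → G (r, t) ≤ 0)
    (hbd : ∀ t ∈ Icc 0 t₁, W (0, t) ≤ 0)
    (h0 : ∀ r ∈ Icc 0 (1 - Real.exp (-t₁) + δ), W (r, 0) ≤ 0)
    (h1 : ∀ r ∈ Icc 0 (1 - Real.exp (-t₁) + δ),
      W' (r, 0) (1, 0) + W' (r, 0) (0, 1) - W (r, 0) / 2 ≤ 0)
    {r t : ℝ} (ht : t ∈ Icc 0 t₁) (hr : r ∈ Icc 0 (Real.exp (-t) - Real.exp (-t₁) + δ)) :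
    W (r, t) ≤ 0 := by
  set K : Set (ℝ × ℝ) :=
    {v | v.2 ∈ Icc 0 t₁ ∧ v.1 ∈ Icc 0 (Real.exp (-v.2) - Real.exp (-t₁) + δ)} with hKdef
  have hKc : IsCompact K := by
    have hcl : IsClosed K := by
      have : K = ({v : ℝ × ℝ | 0 ≤ v.2} ∩ {v | v.2 ≤ t₁}) ∩ ({v | 0 ≤ v.1} ∩
          {v | v.1 ≤ Real.exp (-v.2) - Real.exp (-t₁) + δ}) := rfl
      rw [this]
      refine ((isClosed_le ?_ ?_).inter (isClosed_le ?_ ?_)).inter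
        ((isClosed_le ?_ ?_).inter (isClosed_le ?_ ?_)) <;> fun_prop
    refine ((isCompact_Icc (a := (0 : ℝ)) (b := 1 - Real.exp (-t₁) + δ)).prod
      (isCompact_Icc (a := (0 : ℝ)) (b := t₁))).of_isClosed_subset hcl ?_
    rintro ⟨r, t⟩ ⟨h1, h2⟩
    refine ⟨⟨h2.1, h2.2.trans ?_⟩, h1⟩
    have : Real.exp (-t) ≤ 1 := Real.exp_le_one_iff.2 (by simpa using h1.1)
    simp only
    linarith
  -- With V = W_t + e^{-t} W_r - W/2 the equation becomes (∂_t + e^{-t}∂_r) W = V + W/2 and (∂_t -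
  -- e^{-t}∂_r) V = (M² - 1/4) W - V/2 + G. The shift by W/2 absorbs the first-order term produced
  -- by the variable speed.
  let v : Bool → ℝ × ℝ → ℝ := fun i P =>
    if i then W' P (1 * Real.exp (-P.2), 1) - W P / 2 else W P
  have key := cooperative_nonpos hKc v ?_ (M ^ 2 + 2) ?_
  · exact key false (r, t) ⟨ht, hr⟩
  · rintro (_ | _)
    · exact h.continuousOn
    · simp only [v, if_true]
      refine (h.continuousOn_deriv.clm_apply ?_).sub (h.continuousOn.div_const 2)
      fun_prop
  · rintro (_ | _) ⟨r, t⟩ hP hpos hmax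
    · have hp := hmax true
      simp only [v, if_true, Bool.false_eq_true, if_false] at hpos hp ⊢
      have hP' := hP
      obtain ⟨⟨ht0, ht1⟩, hr0, hr1⟩ := hP'
      simp only at ht0 ht1 hr0 hr1
      -- A point where W is positive lies neither on the initial line nor on the wall r = 0, so the
      -- characteristic that runs towards the wall backwards in time stays in `K` for a short while.
      have ht : 0 < t := by
        rcases ht0.eq_or_lt with rfl | h'
        · exact absurd (h0 r ⟨hr0, by simpa using hr1⟩) (not_le.2 hpos)
        · exact h'
      have hr : 0 < r := by
        rcases hr0.eq_or_lt with rfl | h'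
        · exact absurd (hbd t ⟨ht0, ht1⟩) (not_le.2 hpos)
        · exact h'
      refine ⟨_, _, ?_, ?_, fun τ => rfl, h.hasDerivAt_comp_curve hP ht (-1), ?_⟩
      · simp
      · have hc := (hasDerivAt_characteristic r t (-1)).continuousAt.tendsto
        have e1 : ∀ᶠ τ in 𝓝[>] (0 : ℝ),
            0 < r + -1 * (Real.exp (-(t - τ)) - Real.exp (-t)) := by
          have := (continuous_fst.tendsto _).comp hc
          refine (this.mono_left nhdsWithin_le_nhds).eventually (lt_mem_nhds ?_)
          simpa using hr
        filter_upwards [e1, self_mem_nhdsWithin,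
          nhdsWithin_le_nhds (Iio_mem_nhds ht)] with τ h1 (h2 : 0 < τ) (h3 : τ < t)
        have h4 : Real.exp (-t) ≤ Real.exp (-(t - τ)) := Real.exp_le_exp.2 (by linarith)
        refine ⟨⟨?_, ?_⟩, h1.le, ?_⟩ <;> simp only <;> linarith
      · rw [clm_pair_apply] at hp
        nlinarith [sq_nonneg M]
    · have hp := hmax false
      simp only [v, if_true, Bool.false_eq_true, if_false] at hpos hp ⊢
      have hP' := hP
      obtain ⟨⟨ht0, ht1⟩, hr0, hr1⟩ := hP'
      simp only at ht0 ht1 hr0 hr1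
      have ht : 0 < t := by
        rcases ht0.eq_or_lt with rfl | h'
        · have := h1 r ⟨hr0, by simpa using hr1⟩
          rw [clm_pair_apply] at hpos
          simp at hpos
          linarith
        · exact h'
      -- Backwards in time this characteristic moves outwards, parallel to the outer boundary r =
      -- e^{-t} - e^{-t₁} + δ, and hence never leaves `K` through it.
      have d := (h.hasDerivAt_characteristicDeriv hP ht (b := 1) (by norm_num)).sub
        ((h.hasDerivAt_comp_curve hP ht 1).div_const 2)
      refine ⟨fun τ => (r + 1 * (Real.exp (-(t - τ)) - Real.exp (-t)), t - τ), _, ?_, ?_,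
        fun τ => rfl, d.congr_deriv (neg_neg _).symm, ?_⟩
      · simp
      · filter_upwards [self_mem_nhdsWithin,
          nhdsWithin_le_nhds (Iio_mem_nhds ht)] with τ (h2 : 0 < τ) (h3 : τ < t)
        have h4 : Real.exp (-t) ≤ Real.exp (-(t - τ)) := Real.exp_le_exp.2 (by linarith)
        refine ⟨⟨?_, ?_⟩, ?_, ?_⟩ <;> simp only <;> linarith
      · have hg := hG r t ⟨ht, ht1⟩ ⟨hr0, hr1⟩
        -- Here M ≥ 1/2 is decisive: the coefficient of W in the equation for V is nonnegative, so W
        -- may be replaced by the larger V.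
        have hM2 : 0 ≤ M ^ 2 - 1 / 4 := by nlinarith
        have hmul := mul_le_mul_of_nonneg_left hp hM2
        rw [clm_pair_apply _ (1 * _) 1] at hp hpos hmul ⊢
        nlinarith

/-- Comparison on the whole line. -/
theorem nonpos_of_whole_line {t₁ : ℝ}
    (h : IsWaveSolution M {v | v.2 ∈ Icc 0 t₁ ∧ |v.1| ≤ Real.exp (-v.2) - Real.exp (-t₁)} W W' G)
    (hG : ∀ r t, t ∈ Ioc 0 t₁ → |r| ≤ Real.exp (-t) - Real.exp (-t₁) → G (r, t) ≤ 0)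
    (h0 : ∀ r, |r| ≤ 1 - Real.exp (-t₁) → W (r, 0) ≤ 0)
    (h1 : ∀ r, |r| ≤ 1 - Real.exp (-t₁) → W' (r, 0) (0, 1) + |W' (r, 0) (1, 0)| ≤ 0)
    {r t : ℝ} (ht : t ∈ Icc 0 t₁) (hr : |r| ≤ Real.exp (-t) - Real.exp (-t₁)) :
    W (r, t) ≤ 0 := by
  set K : Set (ℝ × ℝ) :=
    {v | v.2 ∈ Icc 0 t₁ ∧ |v.1| ≤ Real.exp (-v.2) - Real.exp (-t₁)} with hKdef
  have hKc : IsCompact K := by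
    have hcl : IsClosed K := by
      have : K = ({v : ℝ × ℝ | 0 ≤ v.2} ∩ {v | v.2 ≤ t₁}) ∩
          {v | |v.1| ≤ Real.exp (-v.2) - Real.exp (-t₁)} := rfl
      rw [this]
      refine ((isClosed_le ?_ ?_).inter (isClosed_le ?_ ?_)).inter (isClosed_le ?_ ?_) <;> fun_prop
    refine ((isCompact_Icc (a := (-1 : ℝ)) (b := 1)).prod
      (isCompact_Icc (a := (0 : ℝ)) (b := t₁))).of_isClosed_subset hcl ?_
    rintro ⟨r, t⟩ ⟨h1, h2⟩
    refine ⟨abs_le.1 (h2.trans ?_), h1⟩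
    have : Real.exp (-t) ≤ 1 := Real.exp_le_one_iff.2 (by simpa using h1.1)
    have := Real.exp_pos (-t₁)
    simp only
    linarith
  -- With P± = W_t ± e^{-t} W_r: W_t = (P₊ + P₋)/2, and the derivative of P± along the opposite
  -- characteristic is M² W + G - P±/2 + P∓/2. All off-diagonal coefficients are nonnegative for
  -- every M.
  let v : Option Bool → ℝ × ℝ → ℝ := fun i P => match i with
    | none => W P
    | some b => W' P ((if b then 1 else -1) * Real.exp (-P.2), 1)
  have key := cooperative_nonpos hKc v ?_ (M ^ 2 + 2) ?_
  · exact key none (r, t) ⟨ht, hr⟩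
  · rintro (_ | b)
    · exact h.continuousOn
    · simp only [v]
      refine h.continuousOn_deriv.clm_apply ?_
      fun_prop
  · rintro (_ | b) ⟨r, t⟩ hP hpos hmax
    · have hp := hmax (some true)
      have hq := hmax (some false)
      simp only [v, if_true, Bool.false_eq_true, if_false] at hpos hp hq ⊢
      have hP' := hP
      obtain ⟨⟨ht0, ht1⟩, hr1⟩ := hP'
      simp only at ht0 ht1 hr1
      have ht : 0 < t := by
        rcases ht0.eq_or_lt with rfl | h'
        · exact absurd (h0 r (by simpa using hr1)) (not_le.2 hpos)
        · exact h'
      refine ⟨_, _, ?_, ?_, fun τ => rfl, h.hasDerivAt_comp_curve hP ht 0, ?_⟩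
      · simp
      · filter_upwards [self_mem_nhdsWithin,
          nhdsWithin_le_nhds (Iio_mem_nhds ht)] with τ (h2 : 0 < τ) (h3 : τ < t)
        have h4 : Real.exp (-t) ≤ Real.exp (-(t - τ)) := Real.exp_le_exp.2 (by linarith)
        refine ⟨⟨?_, ?_⟩, ?_⟩ <;> simp only [zero_mul, add_zero] <;> linarith
      · rw [clm_pair_apply] at hp hq
        nlinarith [sq_nonneg M]
    · have hw := hmax none
      have hq := hmax (some (!b))
      simp only [v] at hpos hw hq ⊢
      have hP' := hP
      obtain ⟨⟨ht0, ht1⟩, hr1⟩ := hP'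
      simp only at ht0 ht1 hr1
      set c : ℝ := if b then 1 else -1 with hc
      have hc' : (if (!b) = true then (1 : ℝ) else -1) = -c := by cases b <;> simp [hc]
      have hc2 : c ^ 2 = 1 := by cases b <;> simp [hc]
      have hcabs : |c| = 1 := by cases b <;> simp [hc]
      rw [hc'] at hq
      have ht : 0 < t := by
        rcases ht0.eq_or_lt with rfl | h'
        · have := h1 r (by simpa using hr1)
          rw [clm_pair_apply] at hpos
          have h2 : c * W' (r, 0) (1, 0) ≤ |W' (r, 0) (1, 0)| := by
            calc _ ≤ |c * W' (r, 0) (1, 0)| := le_abs_self _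
              _ = _ := by rw [abs_mul, hcabs, one_mul]
          simp at hpos
          linarith
        · exact h'
      refine ⟨_, _, ?_, ?_, fun τ => rfl, h.hasDerivAt_characteristicDeriv hP ht hc2, ?_⟩
      · simp
      · filter_upwards [self_mem_nhdsWithin,
          nhdsWithin_le_nhds (Iio_mem_nhds ht)] with τ (h2 : 0 < τ) (h3 : τ < t)
        have h4 : Real.exp (-t) ≤ Real.exp (-(t - τ)) := Real.exp_le_exp.2 (by linarith)
        refine ⟨⟨?_, ?_⟩, ?_⟩
        · simp only; linarith
        · simp only; linarith
        · have := abs_add_le r (c * (Real.exp (-(t - τ)) - Real.exp (-t)))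
          rw [abs_mul, hcabs, one_mul, abs_of_nonneg (sub_nonneg.2 h4)] at this
          simp only
          linarith
      · have hg := hG r t ⟨ht, ht1⟩ hr1
        have hmul := mul_le_mul_of_nonneg_left hw (sq_nonneg M)
        rw [clm_pair_apply _ (-c * _) 1] at hq
        rw [clm_pair_apply _ (c * _) 1] at hq hpos hmul ⊢
        nlinarith

end IsWaveSolution

/-! ### Integrals over compact sets depending on a parameter -/

section ParametricIntegral

variable {X : Type*} [TopologicalSpace X] [T2Space X]
  [MeasurableSpace X] [BorelSpace X]
  {μ : Measure X} [IsFiniteMeasure μ] {S : Set X}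
  {Y : Type*} [NormedAddCommGroup Y]

theorem ContinuousOn.integrable_of_ae_mem_isCompact (hS : IsCompact S) (hμ : ∀ᵐ ω ∂μ, ω ∈ S)
    {g : X → Y} (hg : ContinuousOn g S) : Integrable g μ := by
  have h : IntegrableOn g S μ := by
    obtain ⟨C, hC⟩ := hS.exists_bound_of_continuousOn hg
    exact IntegrableOn.of_bound (measure_lt_top _ _)
      (hg.aestronglyMeasurable_of_isCompact hS hS.measurableSet) C
      (ae_restrict_of_forall_mem hS.measurableSet hC)
  rwa [IntegrableOn, Measure.restrict_eq_self_of_ae_mem hμ] at h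

theorem ContinuousOn.integrable_slice (hS : IsCompact S) (hμ : ∀ᵐ ω ∂μ, ω ∈ S)
    {Z : Type*} [TopologicalSpace Z] {O : Set (Z × X)} {F : Z → X → Y}
    (hF : ContinuousOn (fun z : Z × X => F z.1 z.2) O) {v : Z} (hv : ∀ ω ∈ S, (v, ω) ∈ O) :
    Integrable (F v) μ :=
  ContinuousOn.integrable_of_ae_mem_isCompact hS hμ
    (hF.comp (f := fun ω => (v, ω)) (by fun_prop) fun ω hω => hv ω hω)

variable [NormedSpace ℝ Y]

theorem continuousOn_integral_of_isCompact (hS : IsCompact S) (hμ : ∀ᵐ ω ∂μ, ω ∈ S)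
    {Z : Type*} [TopologicalSpace Z] [FirstCountableTopology Z] {K : Set Z}
    (hK : IsCompact K) {F : Z → X → Y} (hF : ContinuousOn (fun z : Z × X => F z.1 z.2) (K ×ˢ S)) :
    ContinuousOn (fun v => ∫ ω, F v ω ∂μ) K := by
  obtain ⟨C, hC⟩ := (hK.prod hS).exists_bound_of_continuousOn hF
  refine continuousOn_of_dominated (bound := fun _ => C) (fun v hv => ?_) (fun v hv => ?_)
    (integrable_const C) ?_
  · exact (hF.integrable_slice hS hμ fun ω hω => ⟨hv, hω⟩).1
  · filter_upwards [hμ] with ω hω using hC (v, ω) ⟨hv, hω⟩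
  · filter_upwards [hμ] with ω hω
    exact hF.comp (f := fun v => (v, ω)) (by fun_prop) fun v hv => ⟨hv, hω⟩

/-- The tube lemma gives a closed ball around `v₀` whose product with `S` lies in `O`. This product
is compact, so the derivative is bounded there and a constant serves as dominating function. -/
theorem hasFDerivAt_integral_of_isCompact {V : Type*} [NormedAddCommGroup V]
    [NormedSpace ℝ V] [ProperSpace V] (hS : IsCompact S)
    (hμ : ∀ᵐ ω ∂μ, ω ∈ S) {O : Set (V × X)} (hO : IsOpen O) {F : V → X → Y}
    {F' : V → X → V →L[ℝ] Y} (hF : ContinuousOn (fun z : V × X => F z.1 z.2) O)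
    (hF' : ContinuousOn (fun z : V × X => F' z.1 z.2) O)
    (hd : ∀ z ∈ O, HasFDerivAt (fun v => F v z.2) (F' z.1 z.2) z.1)
    {v₀ : V} (hv₀ : ∀ ω ∈ S, (v₀, ω) ∈ O) :
    HasFDerivAt (fun v => ∫ ω, F v ω ∂μ) (∫ ω, F' v₀ ω ∂μ) v₀ := by
  obtain ⟨A, B, hA, -, hvA, hSB, hAB⟩ := generalized_tube_lemma (isCompact_singleton (x := v₀)) hS
    hO (by rintro ⟨v, ω⟩ ⟨hv, hω⟩; obtain rfl : v = v₀ := hv; exact hv₀ ω hω)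
  obtain ⟨δ, hδ, hδA⟩ := nhds_basis_closedBall.mem_iff.1 (hA.mem_nhds (hvA rfl))
  have hsub : closedBall v₀ δ ×ˢ S ⊆ O := fun z hz => hAB ⟨hδA hz.1, hSB hz.2⟩
  obtain ⟨C, hC⟩ := ((isCompact_closedBall v₀ δ).prod hS).exists_bound_of_continuousOn
    (hF'.mono hsub)
  refine hasFDerivAt_integral_of_dominated_of_fderiv_le (bound := fun _ => C)
    (s := closedBall v₀ δ) (closedBall_mem_nhds v₀ hδ) ?_ ?_ ?_ ?_ (integrable_const C) ?_
  · filter_upwards [closedBall_mem_nhds v₀ hδ] with v hv using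
      (hF.integrable_slice hS hμ fun ω hω => hsub ⟨hv, hω⟩).1
  · exact hF.integrable_slice hS hμ hv₀
  · exact (hF'.integrable_slice hS hμ hv₀).1
  · filter_upwards [hμ] with ω hω v hv using hC (v, ω) ⟨hv, hω⟩
  · filter_upwards [hμ] with ω hω v hv using hd (v, ω) (hsub ⟨hv, hω⟩)

end ParametricIntegral

/-! ### The uniform measure on the sphere and its invariance -/

section SphereMeasure

variable {n : ℕ}

/-- The uniform probability measure on the unit sphere, as a measure on the whole space. -/
noncomputable def sphereMeasure (n : ℕ) : Measure (EuclideanSpace ℝ (Fin n)) :=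
  (ProbabilityTheory.cond volume (closedBall 0 1)).map fun y => ‖y‖⁻¹ • y

theorem measurable_normalize :
    Measurable fun y : EuclideanSpace ℝ (Fin n) => ‖y‖⁻¹ • y :=
  measurable_norm.inv.smul measurable_id

instance : IsProbabilityMeasure (sphereMeasure n) := by
  have : IsProbabilityMeasure (ProbabilityTheory.cond (volume : Measure (EuclideanSpace ℝ (Fin n)))
      (closedBall 0 1)) :=
    ProbabilityTheory.cond_isProbabilityMeasure_of_finite
      (measure_closedBall_pos volume _ one_pos).ne' measure_closedBall_lt_top.ne
  exact Measure.isProbabilityMeasure_map measurable_normalize.aemeasurable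

theorem ae_sphereMeasure_mem_sphere [NeZero n] :
    ∀ᵐ ω ∂sphereMeasure n, ω ∈ sphere (0 : EuclideanSpace ℝ (Fin n)) 1 := by
  refine (ae_map_iff measurable_normalize.aemeasurable isClosed_sphere.measurableSet).2 ?_
  have h0 : ∀ᵐ y ∂(volume : Measure (EuclideanSpace ℝ (Fin n))), y ≠ 0 := Measure.ae_ne volume 0
  have hac : ProbabilityTheory.cond (volume : Measure (EuclideanSpace ℝ (Fin n)))
      (closedBall 0 1) ≪ volume := ProbabilityTheory.cond_absolutelyContinuous
  filter_upwards [hac.ae_le h0] with y hy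
  simp [norm_smul, hy]

/-- Linear isometries preserve Lebesgue measure and the unit ball, and they commute with y ↦ y/|y|.
-/
theorem map_sphereMeasure (L : EuclideanSpace ℝ (Fin n) ≃ₗᵢ[ℝ] EuclideanSpace ℝ (Fin n)) :
    (sphereMeasure n).map L = sphereMeasure n := by
  have hcomp : (L ∘ fun y : EuclideanSpace ℝ (Fin n) => ‖y‖⁻¹ • y) =
      (fun y => ‖y‖⁻¹ • y) ∘ L := by
    ext1 y; simp
  have hL : (ProbabilityTheory.cond volume (closedBall 0 1)).map L =
      ProbabilityTheory.cond (volume : Measure (EuclideanSpace ℝ (Fin n))) (closedBall 0 1) := by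
    rw [ProbabilityTheory.cond, Measure.map_smul]
    congr 1
    have := L.measurePreserving.restrict_preimage
      (s := closedBall (0 : EuclideanSpace ℝ (Fin n)) 1) measurableSet_closedBall
    rw [L.preimage_closedBall, map_zero] at this
    exact this.map_eq
  rw [sphereMeasure, Measure.map_map L.continuous.measurable measurable_normalize, hcomp,
    ← Measure.map_map measurable_normalize L.continuous.measurable, hL]

theorem integral_sphereMeasure_comp {Y : Type*} [NormedAddCommGroup Y] [NormedSpace ℝ Y]
    (L : EuclideanSpace ℝ (Fin n) ≃ₗᵢ[ℝ] EuclideanSpace ℝ (Fin n))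
    (g : EuclideanSpace ℝ (Fin n) → Y) :
    ∫ ω, g (L ω) ∂sphereMeasure n = ∫ ω, g ω ∂sphereMeasure n := by
  conv_rhs => rw [← map_sphereMeasure L]
  exact (integral_map_equiv L.toHomeomorph.toMeasurableEquiv g).symm

end SphereMeasure

section

variable {X : Type*} [TopologicalSpace X] [T2Space X] [MeasurableSpace X] [BorelSpace X]
  {μ : Measure X} [IsFiniteMeasure μ] {S : Set X}
  {Y : Type*} [NormedAddCommGroup Y] [NormedSpace ℝ Y]

theorem hasDerivAt_integral_of_isCompact [CompleteSpace Y] (hS : IsCompact S)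
    (hμ : ∀ᵐ ω ∂μ, ω ∈ S)
    {O : Set (ℝ × X)} (hO : IsOpen O) {F F' : ℝ → X → Y}
    (hF : ContinuousOn (fun z : ℝ × X => F z.1 z.2) O)
    (hF' : ContinuousOn (fun z : ℝ × X => F' z.1 z.2) O)
    (hd : ∀ z ∈ O, HasDerivAt (fun s => F s z.2) (F' z.1 z.2) z.1)
    {s₀ : ℝ} (hs₀ : ∀ ω ∈ S, (s₀, ω) ∈ O) :
    HasDerivAt (fun s => ∫ ω, F s ω ∂μ) (∫ ω, F' s₀ ω ∂μ) s₀ := by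
  have hT : ContinuousOn (fun z : ℝ × X => ContinuousLinearMap.toSpanSingleton ℝ (F' z.1 z.2)) O :=
    (ContinuousLinearMap.toSpanSingletonCLE (𝕜 := ℝ) (E := Y)).continuous.comp_continuousOn hF'
  have h := hasFDerivAt_integral_of_isCompact (μ := μ) hS hμ hO hF
    (F' := fun s ω => ContinuousLinearMap.toSpanSingleton ℝ (F' s ω)) hT
    (fun z hz => (hd z hz).hasFDerivAt) hs₀
  refine h.hasDerivAt.congr_deriv ?_
  rw [ContinuousLinearMap.integral_apply
    (hT.integrable_slice (F := fun s ω => ContinuousLinearMap.toSpanSingleton ℝ (F' s ω)) hS hμ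
      hs₀)]
  simp

end

/-! ### Plane rotations and rotation invariance of spherical means -/

section Rotation

variable {E : Type*} [NormedAddCommGroup E] [InnerProductSpace ℝ E]

/-- The rotation by the angle `θ` in the plane spanned by the orthonormal vectors `e`, `f`. -/
noncomputable def planeRotation (e f : E) (θ : ℝ) : E →ₗ[ℝ] E where
  toFun ω := ω + (Real.cos θ - 1) • (inner ℝ e ω • e + inner ℝ f ω • f) +
    Real.sin θ • (inner ℝ e ω • f - inner ℝ f ω • e)
  map_add' a b := by simp only [inner_add_right]; module
  map_smul' c a := by simp only [inner_smul_right, RingHom.id_apply]; module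

theorem planeRotation_apply (e f : E) (θ : ℝ) (ω : E) :
    planeRotation e f θ ω = ω + (Real.cos θ - 1) • (inner ℝ e ω • e + inner ℝ f ω • f) +
      Real.sin θ • (inner ℝ e ω • f - inner ℝ f ω • e) := rfl

theorem norm_planeRotation {e f : E} (he : ‖e‖ = 1) (hf : ‖f‖ = 1) (hef : inner ℝ e f = 0)
    (θ : ℝ) (ω : E) : ‖planeRotation e f θ ω‖ = ‖ω‖ := by
  set a := inner ℝ e ω with ha
  set b := inner ℝ f ω with hb
  have ha' : inner ℝ ω e = a := real_inner_comm _ _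
  have hb' : inner ℝ ω f = b := real_inner_comm _ _
  have hfe : inner ℝ f e = 0 := by rw [real_inner_comm]; exact hef
  have hee : inner ℝ e e = (1 : ℝ) := by rw [real_inner_self_eq_norm_sq, he]; norm_num
  have hff : inner ℝ f f = (1 : ℝ) := by rw [real_inner_self_eq_norm_sq, hf]; norm_num
  have h : inner ℝ (planeRotation e f θ ω) (planeRotation e f θ ω) = inner ℝ ω ω := by
    have : planeRotation e f θ ω = ω + ((Real.cos θ - 1) * a - Real.sin θ * b) • e +
        ((Real.cos θ - 1) * b + Real.sin θ * a) • f := by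
      rw [planeRotation_apply]; module
    rw [this]
    simp only [inner_add_left, inner_add_right, inner_smul_left, inner_smul_right, ha', hb', hee,
      hff, hfe, hef, ← ha, ← hb, RCLike.conj_to_real]
    linear_combination (a ^ 2 + b ^ 2) * Real.sin_sq_add_cos_sq θ
  rw [real_inner_self_eq_norm_sq, real_inner_self_eq_norm_sq] at h
  exact (sq_eq_sq₀ (norm_nonneg _) (norm_nonneg _)).1 h

theorem hasDerivAt_planeRotation (e f ω : E) (θ : ℝ) :
    HasDerivAt (fun θ => planeRotation e f θ ω)
      ((-Real.sin θ) • (inner ℝ e ω • e + inner ℝ f ω • f) +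
        Real.cos θ • (inner ℝ e ω • f - inner ℝ f ω • e)) θ := by
  simp only [planeRotation_apply]
  exact ((((Real.hasDerivAt_cos θ).sub_const 1).smul_const _).const_add ω).add
    ((Real.hasDerivAt_sin θ).smul_const _)

theorem hasDerivAt_planeRotation_deriv (e f ω : E) (θ : ℝ) :
    HasDerivAt (fun θ => (-Real.sin θ) • (inner ℝ e ω • e + inner ℝ f ω • f) +
        Real.cos θ • (inner ℝ e ω • f - inner ℝ f ω • e))
      ((-Real.cos θ) • (inner ℝ e ω • e + inner ℝ f ω • f) +
        (-Real.sin θ) • (inner ℝ e ω • f - inner ℝ f ω • e)) θ :=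
  (((Real.hasDerivAt_sin θ).neg).smul_const _).add ((Real.hasDerivAt_cos θ).smul_const _)

end Rotation

section SphericalMean

variable {n : ℕ} {D : Set (EuclideanSpace ℝ (Fin n))} {g : EuclideanSpace ℝ (Fin n) → ℝ}

theorem hasDerivAt_fderiv_comp {E : Type*} [NormedAddCommGroup E] [NormedSpace ℝ E] {g : E → ℝ}
    {D : Set E} (hD : IsOpen D) (hg : ContDiffOn ℝ 2 g D) {c c' : ℝ → E} {c'' : E} {s : ℝ}
    (hs : c s ∈ D) (hc : HasDerivAt c (c' s) s) (hc' : HasDerivAt c' c'' s) :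
    HasDerivAt (fun s => fderiv ℝ g (c s) (c' s))
      (fderiv ℝ (fderiv ℝ g) (c s) (c' s) (c' s) + fderiv ℝ g (c s) c'') s := by
  have h1 : ContDiffAt ℝ 1 (fderiv ℝ g) (c s) :=
    (hg.contDiffAt (hD.mem_nhds hs)).fderiv_right (by norm_num)
  have h2 := (h1.differentiableAt (by norm_num)).hasFDerivAt.comp_hasDerivAt s hc
  exact h2.clm_apply hc'

theorem continuousOn_fderiv_of_contDiffOn {E : Type*} [NormedAddCommGroup E] [NormedSpace ℝ E]
    {g : E → ℝ} {D : Set E} (hD : IsOpen D) (hg : ContDiffOn ℝ 2 g D) :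
    ContinuousOn (fderiv ℝ g) D := hg.continuousOn_fderiv_of_isOpen hD (by norm_num)

theorem continuousOn_fderiv_fderiv {E : Type*} [NormedAddCommGroup E] [NormedSpace ℝ E]
    {g : E → ℝ} {D : Set E} (hD : IsOpen D) (hg : ContDiffOn ℝ 2 g D) :
    ContinuousOn (fderiv ℝ (fderiv ℝ g)) D :=
  (hg.fderiv_of_isOpen hD (m := 1) (by norm_num)).continuousOn_fderiv_of_isOpen hD (by norm_num)

/-- Rotation invariance of spherical means, differentiated twice in the angle of rotation. -/
theorem integral_sphere_rotation_eq_zero [NeZero n] (hD : IsOpen D) (hg : ContDiffOn ℝ 2 g D)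
    {x : EuclideanSpace ℝ (Fin n)} {r : ℝ} (hr : ∀ ω, ‖ω‖ = 1 → x + r • ω ∈ D)
    {e f : EuclideanSpace ℝ (Fin n)} (he : ‖e‖ = 1) (hf : ‖f‖ = 1) (hef : inner ℝ e f = 0) :
    ∫ ω, (fderiv ℝ (fderiv ℝ g) (x + r • ω) (r • (inner ℝ e ω • f - inner ℝ f ω • e))
        (r • (inner ℝ e ω • f - inner ℝ f ω • e)) -
      fderiv ℝ g (x + r • ω) (r • (inner ℝ e ω • e + inner ℝ f ω • f))) ∂sphereMeasure n = 0 := by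
  let E := EuclideanSpace ℝ (Fin n)
  let R : ℝ → E → E := fun θ ω => planeRotation e f θ ω
  let R' : ℝ → E → E := fun θ ω => (-Real.sin θ) • (inner ℝ e ω • e + inner ℝ f ω • f) +
        Real.cos θ • (inner ℝ e ω • f - inner ℝ f ω • e)
  let R'' : ℝ → E → E := fun θ ω => (-Real.cos θ) • (inner ℝ e ω • e + inner ℝ f ω • f) +
        (-Real.sin θ) • (inner ℝ e ω • f - inner ℝ f ω • e)
  let O : Set (ℝ × E) := {z | x + r • R z.1 z.2 ∈ D}
  have hRc : Continuous fun z : ℝ × E => x + r • R z.1 z.2 := by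
    simp only [R, planeRotation_apply]; fun_prop
  have hR'c : Continuous fun z : ℝ × E => r • R' z.1 z.2 := by
    simp only [R']; fun_prop
  have hR''c : Continuous fun z : ℝ × E => r • R'' z.1 z.2 := by
    simp only [R'']; fun_prop
  have hO : IsOpen O := hD.preimage hRc
  have hmem : ∀ θ, ∀ ω ∈ sphere (0 : E) 1, (θ, ω) ∈ O := fun θ ω hω =>
    hr _ (by simpa [R, norm_planeRotation he hf hef] using hω)
  have h0 : ContinuousOn (fun z : ℝ × E => g (x + r • R z.1 z.2)) O :=
    hg.continuousOn.comp hRc.continuousOn fun z hz => hz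
  have h1 : ContinuousOn (fun z : ℝ × E => fderiv ℝ g (x + r • R z.1 z.2) (r • R' z.1 z.2)) O :=
    ((continuousOn_fderiv_of_contDiffOn hD hg).comp hRc.continuousOn fun z hz => hz).clm_apply
      hR'c.continuousOn
  have h2 : ContinuousOn (fun z : ℝ × E => fderiv ℝ (fderiv ℝ g) (x + r • R z.1 z.2)
      (r • R' z.1 z.2) (r • R' z.1 z.2) + fderiv ℝ g (x + r • R z.1 z.2) (r • R'' z.1 z.2)) O :=
    ((((continuousOn_fderiv_fderiv hD hg).comp hRc.continuousOn fun z hz => hz).clm_apply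
      hR'c.continuousOn).clm_apply hR'c.continuousOn).add
    (((continuousOn_fderiv_of_contDiffOn hD hg).comp hRc.continuousOn fun z hz => hz).clm_apply
      hR''c.continuousOn)
  have hdR : ∀ θ ω, HasDerivAt (fun θ => x + r • R θ ω) (r • R' θ ω) θ := fun θ ω =>
    ((hasDerivAt_planeRotation e f ω θ).const_smul r).const_add x
  have hI : ∀ θ, HasDerivAt (fun θ => ∫ ω, g (x + r • R θ ω) ∂sphereMeasure n)
      (∫ ω, fderiv ℝ g (x + r • R θ ω) (r • R' θ ω) ∂sphereMeasure n) θ := fun θ =>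
    hasDerivAt_integral_of_isCompact (isCompact_sphere 0 1) ae_sphereMeasure_mem_sphere hO
      (F := fun θ ω => g (x + r • R θ ω)) (F' := fun θ ω => fderiv ℝ g (x + r • R θ ω) (r • R' θ ω))
      h0 h1 (fun z hz => (((hg.contDiffAt (hD.mem_nhds hz)).differentiableAt
        (by norm_num)).hasFDerivAt.comp_hasDerivAt z.1 (hdR z.1 z.2))) (hmem θ)
  have hI' : HasDerivAt
      (fun θ => ∫ ω, fderiv ℝ g (x + r • R θ ω) (r • R' θ ω) ∂sphereMeasure n)
      (∫ ω, (fderiv ℝ (fderiv ℝ g) (x + r • R 0 ω) (r • R' 0 ω) (r • R' 0 ω) +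
        fderiv ℝ g (x + r • R 0 ω) (r • R'' 0 ω)) ∂sphereMeasure n) 0 :=
    hasDerivAt_integral_of_isCompact (isCompact_sphere 0 1) ae_sphereMeasure_mem_sphere hO
      (F := fun θ ω => fderiv ℝ g (x + r • R θ ω) (r • R' θ ω))
      (F' := fun θ ω => fderiv ℝ (fderiv ℝ g) (x + r • R θ ω) (r • R' θ ω) (r • R' θ ω) +
        fderiv ℝ g (x + r • R θ ω) (r • R'' θ ω))
      h1 h2 (fun z hz => hasDerivAt_fderiv_comp hD hg (c := fun θ => x + r • R θ z.2)
        (c' := fun θ => r • R' θ z.2) hz (hdR z.1 z.2)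
        ((hasDerivAt_planeRotation_deriv e f z.2 z.1).const_smul r)) (hmem 0)
  -- Invariance of the measure makes the mean independent of the angle; hence its first derivative
  -- vanishes at every angle, and the second derivative at 0 is the claimed integral.
  have hconst : (fun θ => ∫ ω, g (x + r • R θ ω) ∂sphereMeasure n) =
      fun _ => ∫ ω, g (x + r • ω) ∂sphereMeasure n := by
    ext θ
    let L : E →ₗᵢ[ℝ] E := ⟨planeRotation e f θ, norm_planeRotation he hf hef θ⟩
    exact integral_sphereMeasure_comp (L.toLinearIsometryEquiv rfl) fun ω => g (x + r • ω)
  have hzero : (fun θ => ∫ ω, fderiv ℝ g (x + r • R θ ω) (r • R' θ ω) ∂sphereMeasure n) =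
      fun _ => 0 := by
    ext θ
    have h := hI θ
    rw [hconst] at h
    exact h.unique (hasDerivAt_const _ _)
  rw [hzero] at hI'
  have h := hI'.unique (hasDerivAt_const _ _)
  rw [← h]
  congr 1
  ext ω
  have e0 : R 0 ω = ω := by simp [R, planeRotation_apply]
  have e1 : R' 0 ω = inner ℝ e ω • f - inner ℝ f ω • e := by simp [R']
  have e2 : r • R'' 0 ω = -(r • (inner ℝ e ω • e + inner ℝ f ω • f)) := by
    simp only [R'', Real.cos_zero, Real.sin_zero]; module
  rw [e0, e1, e2, map_neg, sub_eq_add_neg]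

end SphericalMean

/-! ### Darboux's identity in dimension three -/

section DarbouxThree

variable {D : Set (EuclideanSpace ℝ (Fin 3))} {g : EuclideanSpace ℝ (Fin 3) → ℝ}
  {x : EuclideanSpace ℝ (Fin 3)} {r : ℝ}

theorem laplacian_eq_sum_fderiv_fderiv (y : EuclideanSpace ℝ (Fin 3)) :
    (Δ g) y = ∑ i : Fin 3, fderiv ℝ (fderiv ℝ g) y (EuclideanSpace.single i 1)
      (EuclideanSpace.single i 1) := by
  rw [InnerProductSpace.laplacian_eq_iteratedFDeriv_orthonormalBasis g
    (EuclideanSpace.basisFun (Fin 3) ℝ)]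
  simp [iteratedFDeriv_two_apply]

theorem continuousOn_laplacian (hD : IsOpen D) (hg : ContDiffOn ℝ 2 g D) :
    ContinuousOn (Δ g) D := by
  have : Δ g = fun y => ∑ i : Fin 3, fderiv ℝ (fderiv ℝ g) y (EuclideanSpace.single i 1)
      (EuclideanSpace.single i 1) := funext laplacian_eq_sum_fderiv_fderiv
  rw [this]
  exact continuousOn_finsetSum _ fun i _ =>
    ((continuousOn_fderiv_fderiv hD hg).clm_apply continuousOn_const).clm_apply continuousOn_const

/-- This is the pointwise decomposition of the Laplacian in polar coordinates: the squares of the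
three rotation generators add up to r²Δ - r²∂_r² - 2r∂_r. The factor 2 in front of `L ω` is the
dimension minus one, as each coordinate lies in two of the three planes. -/
theorem sum_rotation_eq {L : EuclideanSpace ℝ (Fin 3) →L[ℝ] ℝ}
    {B : EuclideanSpace ℝ (Fin 3) →L[ℝ] EuclideanSpace ℝ (Fin 3) →L[ℝ] ℝ}
    (hB : ∀ a b, B a b = B b a) {ω : EuclideanSpace ℝ (Fin 3)} (hω : ‖ω‖ = 1) (r : ℝ)
    (e : Fin 3 → EuclideanSpace ℝ (Fin 3)) (he : e = fun i => EuclideanSpace.single i 1)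
    (A : Fin 3 → Fin 3 → ℝ)
    (hA : A = fun i j => B (r • (inner ℝ (e i) ω • e j - inner ℝ (e j) ω • e i))
        (r • (inner ℝ (e i) ω • e j - inner ℝ (e j) ω • e i)) -
      L (r • (inner ℝ (e i) ω • e i + inner ℝ (e j) ω • e j))) :
    A 0 1 + A 0 2 + A 1 2 =
      r * (r * (∑ i, B (e i) (e i)) - (2 * L ω + r * B ω ω)) := by
  have hsum : ω = ω 0 • e 0 + ω 1 • e 1 + ω 2 • e 2 := by
    rw [he]; ext i; fin_cases i <;> simp
  have hn : ω 0 ^ 2 + ω 1 ^ 2 + ω 2 ^ 2 = 1 := by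
    have := EuclideanSpace.norm_sq_eq ω
    rw [hω, Fin.sum_univ_three] at this
    simpa using this.symm
  have hi : ∀ i, inner ℝ (e i) ω = ω i := fun i => by
    rw [he]; simp [EuclideanSpace.inner_single_left]
  have hL : L ω = ω 0 * L (e 0) + ω 1 * L (e 1) + ω 2 * L (e 2) := by
    conv_lhs => rw [hsum]
    simp
  have hBω : B ω ω = ω 0 * (ω 0 * B (e 0) (e 0) + ω 1 * B (e 0) (e 1) + ω 2 * B (e 0) (e 2)) +
      ω 1 * (ω 0 * B (e 0) (e 1) + ω 1 * B (e 1) (e 1) + ω 2 * B (e 1) (e 2)) +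
      ω 2 * (ω 0 * B (e 0) (e 2) + ω 1 * B (e 1) (e 2) + ω 2 * B (e 2) (e 2)) := by
    conv_lhs => rw [hsum]
    simp only [map_add, map_smul, _root_.add_apply, _root_.smul_apply, smul_eq_mul]
    rw [hB (e 1) (e 0), hB (e 2) (e 0), hB (e 2) (e 1)]
  rw [hL, hBω, Fin.sum_univ_three, hA]
  simp only [hi, map_add, map_sub, map_smul, _root_.sub_apply, _root_.smul_apply, smul_eq_mul]
  rw [hB (e 1) (e 0), hB (e 2) (e 0), hB (e 2) (e 1)]
  linear_combination (r ^ 2 * (B (e 0) (e 0) + B (e 1) (e 1) + B (e 2) (e 2))) * hn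

/-- Darboux's identity for spherical means in dimension three. -/
theorem integral_sphere_laplacian (hD : IsOpen D) (hg : ContDiffOn ℝ 2 g D)
    (hr : ∀ ω, ‖ω‖ = 1 → x + r • ω ∈ D) :
    ∫ ω, (2 * fderiv ℝ g (x + r • ω) ω + r * fderiv ℝ (fderiv ℝ g) (x + r • ω) ω ω)
      ∂sphereMeasure 3 = r * ∫ ω, (Δ g) (x + r • ω) ∂sphereMeasure 3 := by
  rcases eq_or_ne r 0 with rfl | hr0
  -- For r = 0 the rotations carry no information; the integrand is odd in ω and so has mean zero.
  · have h := integral_sphereMeasure_comp (LinearIsometryEquiv.neg ℝ) fun ω =>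
      2 * fderiv ℝ g x ω
    simp only [LinearIsometryEquiv.coe_neg, map_neg, mul_neg, integral_neg] at h
    simp only [zero_smul, add_zero, zero_mul]
    linarith
  let E := EuclideanSpace ℝ (Fin 3)
  have hS : IsCompact (sphere (0 : E) 1) := isCompact_sphere 0 1
  have hμ := ae_sphereMeasure_mem_sphere (n := 3)
  have hmaps : MapsTo (fun ω : E => x + r • ω) (sphere 0 1) D := fun ω hω =>
    hr ω (by simpa using hω)
  have hpt : ContinuousOn (fun ω : E => x + r • ω) (sphere 0 1) := by fun_prop
  have c1 := (continuousOn_fderiv_of_contDiffOn hD hg).comp hpt hmaps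
  have c2 := (continuousOn_fderiv_fderiv hD hg).comp hpt hmaps
  have c3 := (continuousOn_laplacian hD hg).comp hpt hmaps
  let e : Fin 3 → E := fun i => EuclideanSpace.single i 1
  let A : Fin 3 → Fin 3 → E → ℝ := fun i j ω =>
    fderiv ℝ (fderiv ℝ g) (x + r • ω) (r • (inner ℝ (e i) ω • e j - inner ℝ (e j) ω • e i))
        (r • (inner ℝ (e i) ω • e j - inner ℝ (e j) ω • e i)) -
      fderiv ℝ g (x + r • ω) (r • (inner ℝ (e i) ω • e i + inner ℝ (e j) ω • e j))
  have hA : ∀ i j, i ≠ j → ∫ ω, A i j ω ∂sphereMeasure 3 = 0 := fun i j hij =>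
    integral_sphere_rotation_eq_zero hD hg hr (by simp [e]) (by simp [e])
      (by simp [e, EuclideanSpace.inner_single_left, hij])
  have hAi : ∀ i j, Integrable (A i j) (sphereMeasure 3) := fun i j => by
    refine ContinuousOn.integrable_of_ae_mem_isCompact hS hμ ?_
    exact ((c2.clm_apply (by fun_prop)).clm_apply (by fun_prop)).sub (c1.clm_apply (by fun_prop))
  have i1 : Integrable (fun ω => r * (Δ g) (x + r • ω)) (sphereMeasure 3) :=
    ContinuousOn.integrable_of_ae_mem_isCompact hS hμ (continuousOn_const.mul c3)
  have i2 : Integrable (fun ω => 2 * fderiv ℝ g (x + r • ω) ω +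
      r * fderiv ℝ (fderiv ℝ g) (x + r • ω) ω ω) (sphereMeasure 3) :=
    ContinuousOn.integrable_of_ae_mem_isCompact hS hμ
      ((continuousOn_const.mul (c1.clm_apply continuousOn_id)).add
        (continuousOn_const.mul ((c2.clm_apply continuousOn_id).clm_apply continuousOn_id)))
  have hsum : ∫ ω, (A 0 1 ω + A 0 2 ω + A 1 2 ω) ∂sphereMeasure 3 = 0 := by
    have h01 : Integrable (fun ω => A 0 1 ω + A 0 2 ω) (sphereMeasure 3) := (hAi 0 1).add (hAi 0 2)
    rw [integral_add h01 (hAi 1 2), integral_add (hAi 0 1) (hAi 0 2),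
      hA 0 1 (by decide), hA 0 2 (by decide), hA 1 2 (by decide)]
    norm_num
  have hae : ∀ᵐ ω ∂sphereMeasure 3, A 0 1 ω + A 0 2 ω + A 1 2 ω = r * (r * (Δ g) (x + r • ω) -
      (2 * fderiv ℝ g (x + r • ω) ω + r * fderiv ℝ (fderiv ℝ g) (x + r • ω) ω ω)) := by
    filter_upwards [hμ] with ω hω
    have hsymm : IsSymmSndFDerivAt ℝ g (x + r • ω) :=
      (hg.contDiffAt (hD.mem_nhds (hmaps hω))).isSymmSndFDerivAt (by simp)
    rw [laplacian_eq_sum_fderiv_fderiv]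
    exact sum_rotation_eq (fun a b => hsymm a b) (mem_sphere_zero_iff_norm.1 hω) r e rfl
      (fun i j => A i j ω) rfl
  rw [integral_congr_ae hae, integral_const_mul, integral_sub i1 i2, integral_const_mul] at hsum
  rcases mul_eq_zero.1 hsum with h | h
  · exact absurd h hr0
  · linarith

/-- `r` times the mean of `g` over the sphere of radius `r` around `x`. -/
noncomputable def radialMean (g : EuclideanSpace ℝ (Fin 3) → ℝ) (x : EuclideanSpace ℝ (Fin 3))
    (r : ℝ) : ℝ :=
  ∫ ω, r * g (x + r • ω) ∂sphereMeasure 3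

/-- The derivative of `radialMean g x`. -/
noncomputable def radialMeanDeriv (g : EuclideanSpace ℝ (Fin 3) → ℝ)
    (x : EuclideanSpace ℝ (Fin 3)) (r : ℝ) : ℝ :=
  ∫ ω, (g (x + r • ω) + r * fderiv ℝ g (x + r • ω) ω) ∂sphereMeasure 3

theorem hasDerivAt_radialMean (hD : IsOpen D) (hg : ContDiffOn ℝ 2 g D)
    (hr : ∀ ω, ‖ω‖ = 1 → x + r • ω ∈ D) :
    HasDerivAt (radialMean g x) (radialMeanDeriv g x r) r := by
  have hpt : Continuous fun z : ℝ × EuclideanSpace ℝ (Fin 3) => x + z.1 • z.2 := by fun_prop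
  refine hasDerivAt_integral_of_isCompact (isCompact_sphere 0 1) ae_sphereMeasure_mem_sphere
    (O := {z | x + z.1 • z.2 ∈ D}) (F := fun s ω => s * g (x + s • ω))
    (F' := fun s ω => g (x + s • ω) + s * fderiv ℝ g (x + s • ω) ω) (hD.preimage hpt) ?_ ?_ ?_
    (fun ω hω => hr ω (by simpa using hω))
  · exact continuousOn_fst.mul (hg.continuousOn.comp hpt.continuousOn fun z hz => hz)
  · exact (hg.continuousOn.comp hpt.continuousOn fun z hz => hz).add (continuousOn_fst.mul
      (((continuousOn_fderiv_of_contDiffOn hD hg).comp hpt.continuousOn fun z hz => hz).clm_apply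
        continuousOn_snd))
  · rintro ⟨s, ω⟩ hz
    have hc : HasDerivAt (fun s : ℝ => x + s • ω) ω s := by
      simpa using ((hasDerivAt_id' s).smul_const ω).const_add x
    refine ((hasDerivAt_id' s).mul (((hg.contDiffAt (hD.mem_nhds hz)).differentiableAt
        (by norm_num)).hasFDerivAt.comp_hasDerivAt s hc)).congr_deriv ?_
    simp

/-- The second r-derivative of r g(x + rω) is 2 g_r + r g_rr, whose mean Darboux's identity
evaluates. The factor r in `radialMean` thus removes the first-order term of the radial Laplacian.
-/
theorem hasDerivAt_radialMeanDeriv (hD : IsOpen D) (hg : ContDiffOn ℝ 2 g D)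
    (hr : ∀ ω, ‖ω‖ = 1 → x + r • ω ∈ D) :
    HasDerivAt (radialMeanDeriv g x) (r * ∫ ω, (Δ g) (x + r • ω) ∂sphereMeasure 3) r := by
  rw [← integral_sphere_laplacian hD hg hr]
  have hpt : Continuous fun z : ℝ × EuclideanSpace ℝ (Fin 3) => x + z.1 • z.2 := by fun_prop
  have c0 : ContinuousOn (fun z : ℝ × EuclideanSpace ℝ (Fin 3) => g (x + z.1 • z.2))
      {z | x + z.1 • z.2 ∈ D} := hg.continuousOn.comp hpt.continuousOn fun z hz => hz
  have c1 : ContinuousOn (fun z : ℝ × EuclideanSpace ℝ (Fin 3) => fderiv ℝ g (x + z.1 • z.2))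
      {z | x + z.1 • z.2 ∈ D} :=
    (continuousOn_fderiv_of_contDiffOn hD hg).comp hpt.continuousOn fun z hz => hz
  have c2 : ContinuousOn (fun z : ℝ × EuclideanSpace ℝ (Fin 3) =>
      fderiv ℝ (fderiv ℝ g) (x + z.1 • z.2)) {z | x + z.1 • z.2 ∈ D} :=
    (continuousOn_fderiv_fderiv hD hg).comp hpt.continuousOn fun z hz => hz
  refine hasDerivAt_integral_of_isCompact (isCompact_sphere 0 1) ae_sphereMeasure_mem_sphere
    (O := {z | x + z.1 • z.2 ∈ D})
    (F' := fun s ω => 2 * fderiv ℝ g (x + s • ω) ω + s * fderiv ℝ (fderiv ℝ g) (x + s • ω) ω ω)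
    (hD.preimage hpt) ?_ ?_ ?_ (fun ω hω => hr ω (by simpa using hω))
  · exact c0.add (continuousOn_fst.mul (c1.clm_apply continuousOn_snd))
  · exact (continuousOn_const.mul (c1.clm_apply continuousOn_snd)).add
      (continuousOn_fst.mul ((c2.clm_apply continuousOn_snd).clm_apply continuousOn_snd))
  · rintro ⟨s, ω⟩ hz
    have hc : HasDerivAt (fun s : ℝ => x + s • ω) ω s := by
      simpa using ((hasDerivAt_id' s).smul_const ω).const_add x
    have h1 := ((hg.contDiffAt (hD.mem_nhds hz)).differentiableAt
        (by norm_num)).hasFDerivAt.comp_hasDerivAt s hc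
    have h2 := hasDerivAt_fderiv_comp hD hg (c := fun s => x + s • ω) (c' := fun _ => ω) hz hc
      (hasDerivAt_const _ _)
    refine (h1.add ((hasDerivAt_id' s).mul h2)).congr_deriv ?_
    simp
    ring

theorem radialMean_zero : radialMean g x 0 = 0 := by simp [radialMean]

theorem radialMean_neg : radialMean g x (-r) = -radialMean g x r := by
  have h := integral_sphereMeasure_comp (LinearIsometryEquiv.neg ℝ) fun ω => -r * g (x + -r • ω)
  rw [radialMean, ← h, radialMean, ← integral_neg]
  simp

theorem radialMeanDeriv_zero : radialMeanDeriv g x 0 = g x := by simp [radialMeanDeriv]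

end DarbouxThree

/-! ### Spherical means of superharmonic functions -/

namespace DeSitter.SuperharmonicOn

variable {g : EuclideanSpace ℝ (Fin 3) → ℝ} {x : EuclideanSpace ℝ (Fin 3)} {ρ : ℝ}

theorem mono {U U' : Set (EuclideanSpace ℝ (Fin 3))} (h : SuperharmonicOn g U') (hU : U ⊆ U') :
    SuperharmonicOn g U := ⟨h.1.mono hU, fun y hy => h.2 y (hU hy)⟩

theorem add_smul_mem_ball {r : ℝ} (hr : |r| < ρ) (ω : EuclideanSpace ℝ (Fin 3)) (hω : ‖ω‖ = 1) :
    x + r • ω ∈ ball x ρ := by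
  simpa [norm_smul, hω] using hr

theorem integral_laplacian_nonpos (h : SuperharmonicOn g (ball x ρ)) {r : ℝ} (hr : |r| < ρ) :
    ∫ ω, (Δ g) (x + r • ω) ∂sphereMeasure 3 ≤ 0 := by
  refine integral_nonpos_of_ae ?_
  filter_upwards [ae_sphereMeasure_mem_sphere (n := 3)] with ω hω
  exact h.2 _ (add_smul_mem_ball hr ω (by simpa using hω))

/-- The derivative of `radialMeanDeriv` is r times a nonpositive mean, so it has the sign of -r and
the maximum is attained at r = 0. -/
theorem radialMeanDeriv_le (h : SuperharmonicOn g (ball x ρ)) {r : ℝ} (hr : |r| < ρ) :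
    radialMeanDeriv g x r ≤ g x := by
  have hd : ∀ s, |s| ≤ |r| → HasDerivAt (radialMeanDeriv g x)
      (s * ∫ ω, (Δ g) (x + s • ω) ∂sphereMeasure 3) s := fun s hs =>
    hasDerivAt_radialMeanDeriv isOpen_ball h.1 (add_smul_mem_ball (hs.trans_lt hr))
  rw [← radialMeanDeriv_zero (g := g) (x := x)]
  rcases le_total 0 r with h0 | h0
  · rw [abs_of_nonneg h0] at hd hr
    have habs : ∀ s ∈ Icc 0 r, |s| ≤ r := fun s hs => by rw [abs_of_nonneg hs.1]; exact hs.2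
    refine antitoneOn_of_deriv_nonpos (convex_Icc 0 r)
      (fun s hs => (hd s (habs s hs)).continuousAt.continuousWithinAt)
      (fun s hs => (hd s (habs s (interior_subset hs))).differentiableAt.differentiableWithinAt)
      (fun s hs => ?_) (left_mem_Icc.2 h0) (right_mem_Icc.2 h0) h0
    have hs := interior_subset hs
    rw [(hd s (habs s hs)).deriv]
    exact mul_nonpos_of_nonneg_of_nonpos hs.1
      (h.integral_laplacian_nonpos ((habs s hs).trans_lt hr))
  · rw [abs_of_nonpos h0] at hd hr
    have habs : ∀ s ∈ Icc r 0, |s| ≤ -r := fun s hs => by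
      rw [abs_of_nonpos hs.2]; linarith [hs.1]
    refine monotoneOn_of_deriv_nonneg (convex_Icc r 0)
      (fun s hs => (hd s (habs s hs)).continuousAt.continuousWithinAt)
      (fun s hs => (hd s (habs s (interior_subset hs))).differentiableAt.differentiableWithinAt)
      (fun s hs => ?_) (left_mem_Icc.2 h0) (right_mem_Icc.2 h0) h0
    have hs := interior_subset hs
    rw [(hd s (habs s hs)).deriv]
    exact mul_nonneg_of_nonpos_of_nonpos hs.2
      (h.integral_laplacian_nonpos ((habs s hs).trans_lt hr))

/-- Equivalently, `radialMean g x r` - r g(x) is nonincreasing on the whole interval, negative r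
included. This is the monotonicity of the source and of the initial velocity of W. -/
theorem radialMean_sub_le (h : SuperharmonicOn g (ball x ρ)) {r s : ℝ} (hr : |r| < ρ)
    (hs : |s| < ρ) (hrs : r ≤ s) :
    radialMean g x s - radialMean g x r ≤ (s - r) * g x := by
  have habs : ∀ q ∈ Icc r s, |q| < ρ := fun q hq =>
    abs_lt.2 ⟨(abs_lt.1 hr).1.trans_le hq.1, hq.2.trans_lt (abs_lt.1 hs).2⟩
  have hd : ∀ q ∈ Icc r s, HasDerivAt (radialMean g x) (radialMeanDeriv g x q) q := fun q hq =>
    hasDerivAt_radialMean isOpen_ball h.1 (add_smul_mem_ball (habs q hq))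
  have := (convex_Icc r s).image_sub_le_mul_sub_of_deriv_le (C := g x)
    (fun q hq => (hd q hq).continuousAt.continuousWithinAt)
    (fun q hq => (hd q (interior_subset hq)).differentiableAt.differentiableWithinAt)
    (fun q hq => by
      rw [(hd q (interior_subset hq)).deriv]
      exact h.radialMeanDeriv_le (habs q (interior_subset hq)))
    r (left_mem_Icc.2 hrs) s (right_mem_Icc.2 hrs) hrs
  linarith

theorem radialMean_le (h : SuperharmonicOn g (ball x ρ)) {r : ℝ} (h0 : 0 ≤ r) (hr : r < ρ) :
    radialMean g x r ≤ r * g x := by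
  have := h.radialMean_sub_le (r := 0) (s := r) (by simpa using h0.trans_lt hr)
    (by rwa [abs_of_nonneg h0]) h0
  simpa [radialMean_zero] using this

/-- With m = `radialMean g x`, the function r m' - m vanishes at 0 and has derivative r m'' = r² ·
mean of Δg ≤ 0. -/
theorem mul_radialMeanDeriv_le (h : SuperharmonicOn g (ball x ρ)) {r : ℝ} (h0 : 0 ≤ r)
    (hr : r < ρ) : r * radialMeanDeriv g x r ≤ radialMean g x r := by
  have habs : ∀ s ∈ Icc 0 r, |s| < ρ := fun s hs => by
    rw [abs_of_nonneg hs.1]; exact hs.2.trans_lt hr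
  have hd : ∀ s ∈ Icc 0 r, HasDerivAt (fun s => s * radialMeanDeriv g x s - radialMean g x s)
      (s * (s * ∫ ω, (Δ g) (x + s • ω) ∂sphereMeasure 3)) s := fun s hs => by
    have hm := add_smul_mem_ball (x := x) (habs s hs)
    refine (((hasDerivAt_id' s).mul (hasDerivAt_radialMeanDeriv isOpen_ball h.1 hm)).sub
      (hasDerivAt_radialMean isOpen_ball h.1 hm)).congr_deriv ?_
    ring
  have := antitoneOn_of_deriv_nonpos (convex_Icc 0 r)
      (fun s hs => (hd s hs).continuousAt.continuousWithinAt)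
      (fun s hs => (hd s (interior_subset hs)).differentiableAt.differentiableWithinAt)
      (fun s hs => by
        have hs := interior_subset hs
        rw [(hd s hs).deriv, ← mul_assoc]
        exact mul_nonpos_of_nonneg_of_nonpos (mul_self_nonneg s)
          (h.integral_laplacian_nonpos (habs s hs)))
      (left_mem_Icc.2 h0) (right_mem_Icc.2 h0) h0
  simp only [radialMean_zero] at this
  linarith

end DeSitter.SuperharmonicOn

/-! ### The Duhamel formula and the domain of dependence -/

namespace DeSitter

section Duhamel

variable {M : ℝ}

theorem hasDerivAt_sinhOver (M s : ℝ) : HasDerivAt (sinhOver M) (Real.cosh (M * s)) s := by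
  rcases eq_or_ne M 0 with rfl | hM
  · have : sinhOver 0 = id := by ext s; simp [sinhOver]
    rw [this]
    simpa using hasDerivAt_id s
  · have : sinhOver M = fun s => 1 / M * Real.sinh (M * s) := by ext s; simp [sinhOver, hM]
    rw [this]
    have h : HasDerivAt (fun s : ℝ => M * s) M s := by simpa using (hasDerivAt_id' s).const_mul M
    refine (h.sinh.const_mul (1 / M)).congr_deriv ?_
    field_simp

theorem hasDerivAt_cosh_mul (M s : ℝ) :
    HasDerivAt (fun s => Real.cosh (M * s)) (M ^ 2 * sinhOver M s) s := by
  have h : HasDerivAt (fun s : ℝ => M * s) M s := by simpa using (hasDerivAt_id' s).const_mul M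
  refine h.cosh.congr_deriv ?_
  rcases eq_or_ne M 0 with rfl | hM
  · simp
  · simp only [sinhOver, hM, if_false]; field_simp

theorem sinhOver_zero (M : ℝ) : sinhOver M 0 = 0 := by simp [sinhOver]

theorem sinhOver_nonneg (hM : 0 ≤ M) {s : ℝ} (hs : 0 ≤ s) : 0 ≤ sinhOver M s := by
  rcases eq_or_ne M 0 with rfl | hM0
  · simpa [sinhOver] using hs
  · simp only [sinhOver, hM0, if_false]
    have := Real.sinh_nonneg_iff.2 (mul_nonneg hM hs)
    positivity

theorem sinhOver_sub (M t b : ℝ) : sinhOver M (t - b) =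
    sinhOver M t * Real.cosh (M * b) - Real.cosh (M * t) * sinhOver M b := by
  rcases eq_or_ne M 0 with rfl | hM
  · simp [sinhOver]
  · simp only [sinhOver, hM, if_false, mul_sub, Real.sinh_sub]; ring

theorem cosh_sq_sub_sinhOver_sq (M t : ℝ) :
    Real.cosh (M * t) ^ 2 - M ^ 2 * sinhOver M t ^ 2 = 1 := by
  rcases eq_or_ne M 0 with rfl | hM
  · simp
  · simp only [sinhOver, hM, if_false]
    have : M ^ 2 * (1 / M * Real.sinh (M * t)) ^ 2 = Real.sinh (M * t) ^ 2 := by field_simp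
    rw [this]
    exact Real.cosh_sq_sub_sinh_sq (M * t)

theorem continuous_sinhOver (M : ℝ) : Continuous (sinhOver M) :=
  continuous_iff_continuousAt.2 fun s => (hasDerivAt_sinhOver M s).continuousAt

/-- The solution of `Q'' = M² Q + h`, `Q 0 = a`, `Q' 0 = b`. -/
noncomputable def duhamel (M : ℝ) (h : ℝ → ℝ) (a b t : ℝ) : ℝ :=
  (∫ s in (0 : ℝ)..t, h s * sinhOver M (t - s)) + Real.cosh (M * t) * a + sinhOver M t * b

/-- The derivative of `duhamel M h a b`. -/
noncomputable def duhamelDeriv (M : ℝ) (h : ℝ → ℝ) (a b t : ℝ) : ℝ :=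
  Real.cosh (M * t) * (∫ s in (0 : ℝ)..t, h s * Real.cosh (M * s)) -
    M ^ 2 * sinhOver M t * (∫ s in (0 : ℝ)..t, h s * sinhOver M s) +
    M ^ 2 * sinhOver M t * a + Real.cosh (M * t) * b

variable {h : ℝ → ℝ}

/-- The addition formula takes `t` out of the integrand, so that the fundamental theorem of calculus
suffices for differentiation. -/
theorem duhamel_eq (hh : Continuous h) (a b t : ℝ) : duhamel M h a b t =
    sinhOver M t * (∫ s in (0 : ℝ)..t, h s * Real.cosh (M * s)) -
    Real.cosh (M * t) * (∫ s in (0 : ℝ)..t, h s * sinhOver M s) +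
    Real.cosh (M * t) * a + sinhOver M t * b := by
  have hS := continuous_sinhOver M
  rw [duhamel, ← intervalIntegral.integral_const_mul, ← intervalIntegral.integral_const_mul,
    ← intervalIntegral.integral_sub]
  · simp only [sinhOver_sub]
    congr 3
    ext s
    ring_nf
  · exact (by fun_prop : Continuous _).intervalIntegrable _ _
  · exact (by fun_prop : Continuous _).intervalIntegrable _ _

theorem hasDerivAt_duhamel (hh : Continuous h) (a b t : ℝ) :
    HasDerivAt (duhamel M h a b) (duhamelDeriv M h a b t) t := by
  have hS := continuous_sinhOver M
  have h1 : HasDerivAt (fun t => ∫ s in (0 : ℝ)..t, h s * Real.cosh (M * s))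
      (h t * Real.cosh (M * t)) t :=
    (by fun_prop : Continuous fun s => h s * Real.cosh (M * s)).integral_hasStrictDerivAt 0 t
      |>.hasDerivAt
  have h2 : HasDerivAt (fun t => ∫ s in (0 : ℝ)..t, h s * sinhOver M s) (h t * sinhOver M t) t :=
    (by fun_prop : Continuous fun s => h s * sinhOver M s).integral_hasStrictDerivAt 0 t
      |>.hasDerivAt
  rw [funext (duhamel_eq (M := M) hh a b)]
  refine (((((hasDerivAt_sinhOver M t).mul h1).sub ((hasDerivAt_cosh_mul M t).mul h2)).add
    ((hasDerivAt_cosh_mul M t).mul_const a)).add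
      ((hasDerivAt_sinhOver M t).mul_const b)).congr_deriv ?_
  simp only [duhamelDeriv]
  ring

theorem hasDerivAt_duhamelDeriv (hh : Continuous h) (a b t : ℝ) :
    HasDerivAt (duhamelDeriv M h a b) (M ^ 2 * duhamel M h a b t + h t) t := by
  have hS := continuous_sinhOver M
  have h1 : HasDerivAt (fun t => ∫ s in (0 : ℝ)..t, h s * Real.cosh (M * s))
      (h t * Real.cosh (M * t)) t :=
    (by fun_prop : Continuous fun s => h s * Real.cosh (M * s)).integral_hasStrictDerivAt 0 t
      |>.hasDerivAt
  have h2 : HasDerivAt (fun t => ∫ s in (0 : ℝ)..t, h s * sinhOver M s) (h t * sinhOver M t) t :=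
    (by fun_prop : Continuous fun s => h s * sinhOver M s).integral_hasStrictDerivAt 0 t
      |>.hasDerivAt
  refine (((((hasDerivAt_cosh_mul M t).mul h1).sub
    (((hasDerivAt_sinhOver M t).const_mul (M ^ 2)).mul h2)).add
    (((hasDerivAt_sinhOver M t).const_mul (M ^ 2)).mul_const a)).add
      ((hasDerivAt_cosh_mul M t).mul_const b)).congr_deriv ?_
  rw [duhamel_eq hh]
  linear_combination h t * cosh_sq_sub_sinhOver_sq M t

theorem continuous_duhamel (hh : Continuous h) (a b : ℝ) : Continuous (duhamel M h a b) :=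
  continuous_iff_continuousAt.2 fun t => (hasDerivAt_duhamel hh a b t).continuousAt

theorem continuous_duhamelDeriv (hh : Continuous h) (a b : ℝ) : Continuous (duhamelDeriv M h a b) :=
  continuous_iff_continuousAt.2 fun t => (hasDerivAt_duhamelDeriv hh a b t).continuousAt

/-- The product rQ(t) is linear in r, so the spatial second derivative drops out and only Q'' - M² Q
= h remains, multiplied by r. -/
theorem isWaveSolution_duhamel (hh : Continuous h) (a b : ℝ) (Ω : Set (ℝ × ℝ)) :
    IsWaveSolution M Ω (fun v => v.1 * duhamel M h a b v.2)
      (fun v => duhamel M h a b v.2 • ContinuousLinearMap.fst ℝ ℝ ℝ +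
        (v.1 * duhamelDeriv M h a b v.2) • ContinuousLinearMap.snd ℝ ℝ ℝ)
      (fun v => v.1 * h v.2) := by
  have c1 := continuous_duhamel (M := M) hh a b
  have c2 := continuous_duhamelDeriv (M := M) hh a b
  have dQ : ∀ v : ℝ × ℝ, HasFDerivAt (fun v : ℝ × ℝ => duhamel M h a b v.2)
      (duhamelDeriv M h a b v.2 • ContinuousLinearMap.snd ℝ ℝ ℝ) v := fun v =>
    (hasDerivAt_duhamel hh a b v.2).comp_hasFDerivAt v hasFDerivAt_snd
  have dQ' : ∀ v : ℝ × ℝ, HasFDerivAt (fun v : ℝ × ℝ => duhamelDeriv M h a b v.2)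
      ((M ^ 2 * duhamel M h a b v.2 + h v.2) • ContinuousLinearMap.snd ℝ ℝ ℝ) v := fun v =>
    (hasDerivAt_duhamelDeriv hh a b v.2).comp_hasFDerivAt v hasFDerivAt_snd
  refine ⟨by fun_prop, by fun_prop, fun v _ _ => ?_, fun v _ _ => ?_⟩
  · refine (hasFDerivAt_fst.mul (dQ v)).congr_fderiv ?_
    ext <;> simp
  · have dm : HasFDerivAt (fun v : ℝ × ℝ => v.1 * duhamelDeriv M h a b v.2) _ v :=
      hasFDerivAt_fst.mul (dQ' v)
    have d1 := (dQ v).smul_const (ContinuousLinearMap.fst ℝ ℝ ℝ)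
    have d2 := dm.smul_const (ContinuousLinearMap.snd ℝ ℝ ℝ)
    refine ⟨_, d1.add d2, ?_, ?_⟩
    · simp
    · simp
      ring

end Duhamel

section Domain

variable {n : ℕ} {D₀ : Set (EuclideanSpace ℝ (Fin n))}

/-- By the triangle inequality, a backward cone containing (x,t) contains the base of the cone with
apex (x,t); so the point itself can be taken as apex. -/
theorem mem_dependenceDomain_iff {x : EuclideanSpace ℝ (Fin n)} {t : ℝ} (ht : 0 ≤ t) :
    (x, t) ∈ dependenceDomain D₀ ↔ closedBall x (1 - Real.exp (-t)) ⊆ D₀ := by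
  constructor
  · rintro ⟨x₀, t₀, -, hsub, hx⟩ y hy
    refine hsub y ?_
    simp only [backwardCone, mem_ofPred_eq, mem_closedBall, dist_eq_norm, neg_zero,
      Real.exp_zero] at *
    have := norm_sub_le_norm_sub_add_norm_sub y x x₀
    linarith
  · intro h
    refine ⟨x, t, ht, fun y hy => h ?_, ?_⟩
    · simp only [backwardCone, mem_ofPred_eq, neg_zero, Real.exp_zero] at hy
      rw [mem_closedBall, dist_eq_norm]
      linarith
    · simp [backwardCone]

theorem mem_dependenceDomain_of_le {x : EuclideanSpace ℝ (Fin n)} {s t : ℝ} (hs : 0 ≤ s)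
    (hst : s ≤ t) (h : (x, t) ∈ dependenceDomain D₀) : (x, s) ∈ dependenceDomain D₀ := by
  rw [mem_dependenceDomain_iff (hs.trans hst)] at h
  rw [mem_dependenceDomain_iff hs]
  refine (closedBall_subset_closedBall ?_).trans h
  have : Real.exp (-t) ≤ Real.exp (-s) := Real.exp_le_exp.2 (by linarith)
  linarith

/-- A neighbourhood of the backward cone below a point of the domain of dependence still lies in
the domain of dependence. -/
theorem exists_cone_subset_dependenceDomain (hD₀ : IsOpen D₀) {x : EuclideanSpace ℝ (Fin n)}
    {t₁ : ℝ} (ht₁ : 0 ≤ t₁) (hx : (x, t₁) ∈ dependenceDomain D₀) :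
    ∃ ε > 0, ε ≤ 1 ∧ ∀ y t, 0 ≤ t → ‖y - x‖ < Real.exp (-t) - Real.exp (-t₁) + ε →
      (y, t) ∈ dependenceDomain D₀ := by
  rw [mem_dependenceDomain_iff ht₁] at hx
  have hr : 0 ≤ 1 - Real.exp (-t₁) := by
    have : Real.exp (-t₁) ≤ 1 := Real.exp_le_one_iff.2 (by linarith)
    linarith
  obtain ⟨δ, hδ, hsub⟩ :=
    (isCompact_closedBall x (1 - Real.exp (-t₁))).exists_cthickening_subset_open hD₀ hx
  rw [cthickening_closedBall hδ.le hr] at hsub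
  -- The cap at 1 keeps radii on the initial slice below 2, which is needed for the sign of the
  -- initial data in the half-line comparison.
  refine ⟨min δ 1, lt_min hδ one_pos, min_le_right _ _, fun y t ht hy => ?_⟩
  rw [mem_dependenceDomain_iff ht]
  refine Subset.trans (fun z hz => ?_) hsub
  rw [mem_closedBall, dist_eq_norm] at *
  have := norm_sub_le_norm_sub_add_norm_sub z y x
  have := min_le_left δ 1
  linarith

end Domain

end DeSitter

section

variable {X : Type*} [TopologicalSpace X] [T2Space X] [MeasurableSpace X] [BorelSpace X]
  {μ : Measure X} [IsFiniteMeasure μ] {S : Set X}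
  {Y : Type*} [NormedAddCommGroup Y] [NormedSpace ℝ Y]

/-- The set `A ∩ B` is locally compact: a small closed ball inside `A`, cut with `B`, is a compact
relative neighbourhood. It is used for regions open in space but closed at t = 0. -/
theorem continuousOn_integral_of_isOpen_inter_isClosed (hS : IsCompact S)
    (hμ : ∀ᵐ ω ∂μ, ω ∈ S) {Z : Type*} [MetricSpace Z] [ProperSpace Z] {A B : Set Z}
    (hA : IsOpen A) (hB : IsClosed B) {F : Z → X → Y}
    (hF : ContinuousOn (fun z : Z × X => F z.1 z.2) ((A ∩ B) ×ˢ S)) :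
    ContinuousOn (fun v => ∫ ω, F v ω ∂μ) (A ∩ B) := by
  intro v hv
  obtain ⟨δ, hδ, hδA⟩ := nhds_basis_closedBall.mem_iff.1 (hA.mem_nhds hv.1)
  have hK : IsCompact (closedBall v δ ∩ B) := (isCompact_closedBall v δ).inter_right hB
  have h := continuousOn_integral_of_isCompact (μ := μ) hS hμ hK
    (hF.mono (prod_mono (inter_subset_inter_left B hδA) subset_rfl)) v
    ⟨mem_closedBall_self hδ.le, hv.2⟩
  refine h.mono_of_mem_nhdsWithin ?_
  filter_upwards [nhdsWithin_le_nhds (closedBall_mem_nhds v hδ), self_mem_nhdsWithin] with w h1 h2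
  exact ⟨h1, h2.2⟩

end

/-! ### Calculus on space-time tubes up to the initial time -/

namespace DeSitter

/-- The part `0 ≤ t < T` of the space-time region `|y - x| < ρ(t)`. -/
def tube (x : EuclideanSpace ℝ (Fin 3)) (ρ : ℝ → ℝ) (T : ℝ) :
    Set (EuclideanSpace ℝ (Fin 3) × ℝ) :=
  {p | ‖p.1 - x‖ < ρ p.2 ∧ p.2 < T} ∩ {p | 0 ≤ p.2}

/-- The part `0 ≤ t < T` of the region `|r| < ρ(t)`. -/
def radialTube (ρ : ℝ → ℝ) (T : ℝ) : Set (ℝ × ℝ) :=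
  {v | |v.1| < ρ v.2 ∧ v.2 < T} ∩ {v | 0 ≤ v.2}

section Tube

variable {x : EuclideanSpace ℝ (Fin 3)} {ρ : ℝ → ℝ} {T T' M : ℝ}
  {u : EuclideanSpace ℝ (Fin 3) × ℝ → ℝ}

theorem isOpen_tube_base (hρ : Continuous ρ) :
    IsOpen {p : EuclideanSpace ℝ (Fin 3) × ℝ | ‖p.1 - x‖ < ρ p.2 ∧ p.2 < T'} :=
  (isOpen_lt (by fun_prop) (by fun_prop)).and (isOpen_lt (by fun_prop) (by fun_prop))

theorem isOpen_radialTube_base (hρ : Continuous ρ) :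
    IsOpen {v : ℝ × ℝ | |v.1| < ρ v.2 ∧ v.2 < T'} :=
  (isOpen_lt (by fun_prop) (by fun_prop)).and (isOpen_lt (by fun_prop) (by fun_prop))

theorem uniqueDiffOn_tube (hρ : Continuous ρ) : UniqueDiffOn ℝ (tube x ρ T') := by
  have h : UniqueDiffOn ℝ {p : EuclideanSpace ℝ (Fin 3) × ℝ | 0 ≤ p.2} := by
    have := (uniqueDiffOn_univ (𝕜 := ℝ) (E := EuclideanSpace ℝ (Fin 3))).prod
      (uniqueDiffOn_Ici (0 : ℝ))
    have he : {p : EuclideanSpace ℝ (Fin 3) × ℝ | 0 ≤ p.2} = univ ×ˢ Ici 0 := by ext p; simp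
    rwa [he]
  rw [tube, inter_comm]
  exact h.inter (isOpen_tube_base hρ)

/-- The interior part `0 < t < T` of the tube. -/
def openTube (x : EuclideanSpace ℝ (Fin 3)) (ρ : ℝ → ℝ) (T : ℝ) :
    Set (EuclideanSpace ℝ (Fin 3) × ℝ) :=
  {p | ‖p.1 - x‖ < ρ p.2 ∧ p.2 < T} ∩ {p | 0 < p.2}

theorem openTube_subset : openTube x ρ T' ⊆ tube x ρ T' := fun _ hp =>
  ⟨hp.1, (show (0 : ℝ) < _ from hp.2).le⟩

theorem isOpen_openTube (hρ : Continuous ρ) : IsOpen (openTube x ρ T') :=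
  (isOpen_tube_base hρ).inter (isOpen_lt (by fun_prop) (by fun_prop))

theorem mem_tube {v : ℝ × ℝ} (hv : v ∈ radialTube ρ T') {ω : EuclideanSpace ℝ (Fin 3)}
    (hω : ‖ω‖ = 1) : (x + v.1 • ω, v.2) ∈ tube x ρ T' := by
  refine ⟨⟨?_, hv.1.2⟩, hv.2⟩
  simpa [norm_smul, hω] using hv.1.1

theorem mem_openTube {v : ℝ × ℝ} (hv : v ∈ radialTube ρ T') (h0 : 0 < v.2)
    {ω : EuclideanSpace ℝ (Fin 3)} (hω : ‖ω‖ = 1) : (x + v.1 • ω, v.2) ∈ openTube x ρ T' :=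
  ⟨(mem_tube hv hω).1, h0⟩

theorem hasFDerivWithinAt_tube (hu : ContDiffOn ℝ 2 u (tube x ρ T'))
    {p : EuclideanSpace ℝ (Fin 3) × ℝ} (hp : p ∈ tube x ρ T') :
    HasFDerivWithinAt u (fderivWithin ℝ u (tube x ρ T') p) (tube x ρ T') p :=
  ((hu p hp).differentiableWithinAt (by norm_num)).hasFDerivWithinAt

theorem hasFDerivAt_openTube (hρ : Continuous ρ) (hu : ContDiffOn ℝ 2 u (tube x ρ T'))
    {p : EuclideanSpace ℝ (Fin 3) × ℝ} (hp : p ∈ openTube x ρ T') :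
    HasFDerivAt u (fderivWithin ℝ u (tube x ρ T') p) p :=
  (hasFDerivWithinAt_tube hu (openTube_subset hp)).hasFDerivAt
    (mem_of_superset ((isOpen_openTube hρ).mem_nhds hp) openTube_subset)

theorem contDiffOn_fderivWithin_tube (hρ : Continuous ρ) (hu : ContDiffOn ℝ 2 u (tube x ρ T')) :
    ContDiffOn ℝ 1 (fderivWithin ℝ u (tube x ρ T')) (tube x ρ T') :=
  hu.fderivWithin (uniqueDiffOn_tube hρ) (by norm_num)

theorem hasFDerivAt_fderivWithin_openTube (hρ : Continuous ρ)
    (hu : ContDiffOn ℝ 2 u (tube x ρ T')) {p : EuclideanSpace ℝ (Fin 3) × ℝ}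
    (hp : p ∈ openTube x ρ T') :
    HasFDerivAt (fderivWithin ℝ u (tube x ρ T'))
      (fderiv ℝ (fderivWithin ℝ u (tube x ρ T')) p) p :=
  (((contDiffOn_fderivWithin_tube hρ hu).contDiffAt
    (mem_of_superset ((isOpen_openTube hρ).mem_nhds hp) openTube_subset)).differentiableAt
      (by norm_num)).hasFDerivAt

/-- Spatial slices of a function on the tube. -/
theorem hasFDerivAt_slice (hρ : Continuous ρ) (hu : ContDiffOn ℝ 2 u (tube x ρ T'))
    {y : EuclideanSpace ℝ (Fin 3)} {t : ℝ} (hp : (y, t) ∈ tube x ρ T') :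
    HasFDerivAt (fun y => u (y, t)) ((fderivWithin ℝ u (tube x ρ T') (y, t)).comp
      (ContinuousLinearMap.inl ℝ _ ℝ)) y := by
  have h := (hasFDerivWithinAt_tube hu hp).comp (f := fun z => (z, t))
    (s := {z | (z, t) ∈ tube x ρ T'}) y
    (hasFDerivAt_prodMk_left y t).hasFDerivWithinAt (fun z hz => hz)
  refine h.hasFDerivAt ?_
  have : IsOpen {z : EuclideanSpace ℝ (Fin 3) | ‖z - x‖ < ρ t ∧ t < T'} :=
    (isOpen_tube_base (x := x) (T' := T') hρ).preimage
      (by fun_prop : Continuous fun z : EuclideanSpace ℝ (Fin 3) => (z, t))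
  filter_upwards [this.mem_nhds hp.1] with z hz using ⟨hz, hp.2⟩

theorem contDiffOn_slice (hu : ContDiffOn ℝ 2 u (tube x ρ T')) {t : ℝ} (ht : t ∈ Ico 0 T') :
    ContDiffOn ℝ 2 (fun y => u (y, t)) (ball x (ρ t)) :=
  hu.comp (by fun_prop : ContDiff ℝ 2 fun y : EuclideanSpace ℝ (Fin 3) => (y, t)).contDiffOn
    fun y hy => ⟨⟨by simpa [dist_eq_norm] using hy, ht.2⟩, ht.1⟩

/-- Near t the vertical slice of the tube is a relative neighbourhood in [0,T], also at t = 0, so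
the one-sided time derivative is a component of the derivative within the tube. -/
theorem derivWithin_time (hρ : Continuous ρ) (hu : ContDiffOn ℝ 2 u (tube x ρ T'))
    (hT : T' ≤ T) {y : EuclideanSpace ℝ (Fin 3)} {t : ℝ} (hp : (y, t) ∈ tube x ρ T') :
    derivWithin (fun s => u (y, s)) (Icc 0 T) t =
      fderivWithin ℝ u (tube x ρ T') (y, t) (0, 1) := by
  have h2 : HasDerivWithinAt (fun s : ℝ => (y, s)) (0, 1) {s | (y, s) ∈ tube x ρ T'} t :=
    ((hasDerivAt_const t y).prodMk (hasDerivAt_id' t)).hasDerivWithinAt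
  have h := (hasFDerivWithinAt_tube hu hp).comp_hasDerivWithinAt t h2 (fun s hs => hs)
  have hpt : t ∈ Icc 0 T := ⟨hp.2, hp.1.2.le.trans hT⟩
  refine HasDerivWithinAt.derivWithin (h.mono_of_mem_nhdsWithin ?_)
    (uniqueDiffOn_Icc (hp.2.trans_lt (hp.1.2.trans_le hT)) t hpt)
  have : IsOpen {s : ℝ | ‖y - x‖ < ρ s ∧ s < T'} :=
    (isOpen_tube_base (x := x) (T' := T') hρ).preimage
      (by fun_prop : Continuous fun s : ℝ => (y, s))
  filter_upwards [nhdsWithin_le_nhds (this.mem_nhds hp.1), self_mem_nhdsWithin] with s h1 h2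
  exact ⟨h1, h2.1⟩

theorem kleinGordon_eq (hρ : Continuous ρ) (hu : ContDiffOn ℝ 2 u (tube x ρ T'))
    (hT : T' ≤ T) {y : EuclideanSpace ℝ (Fin 3)} {t : ℝ} (hp : (y, t) ∈ openTube x ρ T') :
    kleinGordon M T u (y, t) =
      fderiv ℝ (fderivWithin ℝ u (tube x ρ T')) (y, t) (0, 1) (0, 1) -
        Real.exp (-2 * t) * (Δ fun y => u (y, t)) y - M ^ 2 * u (y, t) := by
  have hc : Continuous fun s : ℝ => (y, s) := by fun_prop
  have hnhds : Icc 0 T ∈ 𝓝 t := Icc_mem_nhds hp.2 (hp.1.2.trans_le hT)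
  have hd : HasDerivAt (fun s => fderivWithin ℝ u (tube x ρ T') (y, s) (0, 1))
      (fderiv ℝ (fderivWithin ℝ u (tube x ρ T')) (y, t) (0, 1) (0, 1)) t := by
    have h1 := (hasFDerivAt_fderivWithin_openTube hρ hu hp).comp_hasDerivAt t
      ((hasDerivAt_const t y).prodMk (hasDerivAt_id' t))
    simpa using h1.clm_apply (hasDerivAt_const t ((0, 1) : EuclideanSpace ℝ (Fin 3) × ℝ))
  have h2 : iteratedDerivWithin 2 (fun s => u (y, s)) (Icc 0 T) t =
      fderiv ℝ (fderivWithin ℝ u (tube x ρ T')) (y, t) (0, 1) (0, 1) := by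
    rw [iteratedDerivWithin_succ, derivWithin_of_mem_nhds hnhds, ← hd.deriv]
    refine EventuallyEq.deriv_eq ?_
    filter_upwards [((isOpen_openTube hρ).preimage hc).mem_nhds hp] with s hs
    rw [iteratedDerivWithin_one]
    exact derivWithin_time hρ hu hT (openTube_subset hs)
  simp only [kleinGordon, h2]

/-- The linear map `(a, b) ↦ (a ω, b)`. -/
noncomputable def radialLift (ω : EuclideanSpace ℝ (Fin 3)) :
    ℝ × ℝ →L[ℝ] EuclideanSpace ℝ (Fin 3) × ℝ :=
  (ContinuousLinearMap.inl ℝ _ ℝ).comp ((ContinuousLinearMap.fst ℝ ℝ ℝ).smulRight ω) +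
    (ContinuousLinearMap.inr ℝ _ ℝ).comp (ContinuousLinearMap.snd ℝ ℝ ℝ)

theorem radialLift_apply (ω : EuclideanSpace ℝ (Fin 3)) (v : ℝ × ℝ) :
    radialLift ω v = (v.1 • ω, v.2) := by
  simp [radialLift]

theorem contDiff_radialLift : ContDiff ℝ 1 radialLift := by
  unfold radialLift
  exact (contDiff_const.clm_comp (contDiff_const.smulRight contDiff_id)).add contDiff_const

/-- The integrand of the derivative of `(r, t) ↦ radialMean (u (·, t)) x r`. -/
noncomputable def radialIntegrand (u : EuclideanSpace ℝ (Fin 3) × ℝ → ℝ)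
    (u' : EuclideanSpace ℝ (Fin 3) × ℝ → EuclideanSpace ℝ (Fin 3) × ℝ →L[ℝ] ℝ)
    (x : EuclideanSpace ℝ (Fin 3)) (v : ℝ × ℝ) (ω : EuclideanSpace ℝ (Fin 3)) : ℝ × ℝ →L[ℝ] ℝ :=
  u (x + v.1 • ω, v.2) • ContinuousLinearMap.fst ℝ ℝ ℝ +
    v.1 • (u' (x + v.1 • ω, v.2)).comp (radialLift ω)

theorem radialIntegrand_apply
    (u' : EuclideanSpace ℝ (Fin 3) × ℝ → EuclideanSpace ℝ (Fin 3) × ℝ →L[ℝ] ℝ)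
    (v w : ℝ × ℝ) (ω : EuclideanSpace ℝ (Fin 3)) :
    radialIntegrand u u' x v ω w = u (x + v.1 • ω, v.2) * w.1 +
      v.1 * u' (x + v.1 • ω, v.2) (w.1 • ω, w.2) := by
  simp [radialIntegrand, radialLift_apply]

theorem contDiff_radialPoint (x : EuclideanSpace ℝ (Fin 3)) :
    ContDiff ℝ 1 fun z : (ℝ × ℝ) × EuclideanSpace ℝ (Fin 3) => (x + z.1.1 • z.2, z.1.2) := by
  fun_prop

end Tube

end DeSitter

/-! ### Spherical means turn the equation into a one-dimensional one -/

namespace DeSitter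

variable {x : EuclideanSpace ℝ (Fin 3)} {ρ : ℝ → ℝ} {T T' M : ℝ}
  {u : EuclideanSpace ℝ (Fin 3) × ℝ → ℝ}

theorem hasDerivAt_clm_fst {A : ℝ × ℝ → ℝ × ℝ →L[ℝ] ℝ} {B : ℝ × ℝ →L[ℝ] ℝ × ℝ →L[ℝ] ℝ}
    {r t : ℝ} (h : HasFDerivAt A B (r, t)) (w : ℝ × ℝ) :
    HasDerivAt (fun s => A (s, t) w) (B (1, 0) w) r := by
  have h1 : HasDerivAt (fun s => A (s, t)) (B (1, 0)) r :=
    h.comp_hasDerivAt (f := fun s => (s, t)) r ((hasDerivAt_id' r).prodMk (hasDerivAt_const r t))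
  simpa using h1.clm_apply (hasDerivAt_const r w)

theorem hasDerivAt_clm_snd {A : ℝ × ℝ → ℝ × ℝ →L[ℝ] ℝ} {B : ℝ × ℝ →L[ℝ] ℝ × ℝ →L[ℝ] ℝ}
    {r t : ℝ} (h : HasFDerivAt A B (r, t)) (w : ℝ × ℝ) :
    HasDerivAt (fun s => A (r, s) w) (B (0, 1) w) t := by
  have h1 : HasDerivAt (fun s => A (r, s)) (B (0, 1)) t :=
    h.comp_hasDerivAt (f := fun s => (r, s)) t ((hasDerivAt_const t r).prodMk (hasDerivAt_id' t))
  simpa using h1.clm_apply (hasDerivAt_const t w)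

theorem continuousOn_radialIntegrand (hρ : Continuous ρ) (hu : ContDiffOn ℝ 2 u (tube x ρ T')) :
    ContinuousOn (fun z : (ℝ × ℝ) × EuclideanSpace ℝ (Fin 3) =>
        radialIntegrand u (fderivWithin ℝ u (tube x ρ T')) x z.1 z.2)
      {z | (x + z.1.1 • z.2, z.1.2) ∈ tube x ρ T'} := by
  have hp := (contDiff_radialPoint x).continuous
  have h1 : ContinuousOn (fun z : (ℝ × ℝ) × EuclideanSpace ℝ (Fin 3) =>
      fderivWithin ℝ u (tube x ρ T') (x + z.1.1 • z.2, z.1.2))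
      {z | (x + z.1.1 • z.2, z.1.2) ∈ tube x ρ T'} :=
    (contDiffOn_fderivWithin_tube hρ hu).continuousOn.comp hp.continuousOn fun z hz => hz
  have h0 : ContinuousOn (fun z : (ℝ × ℝ) × EuclideanSpace ℝ (Fin 3) =>
      u (x + z.1.1 • z.2, z.1.2)) {z | (x + z.1.1 • z.2, z.1.2) ∈ tube x ρ T'} :=
    hu.continuousOn.comp hp.continuousOn fun z hz => hz
  unfold radialIntegrand
  exact (h0.smul continuousOn_const).add ((by fun_prop : Continuous fun
    z : (ℝ × ℝ) × EuclideanSpace ℝ (Fin 3) => z.1.1).continuousOn.smul (h1.clm_comp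
      (contDiff_radialLift.continuous.comp continuous_snd).continuousOn))

theorem contDiffOn_radialIntegrand (hρ : Continuous ρ) (hu : ContDiffOn ℝ 2 u (tube x ρ T')) :
    ContDiffOn ℝ 1 (fun z : (ℝ × ℝ) × EuclideanSpace ℝ (Fin 3) =>
        radialIntegrand u (fderivWithin ℝ u (tube x ρ T')) x z.1 z.2)
      {z | (x + z.1.1 • z.2, z.1.2) ∈ openTube x ρ T'} := by
  have hp := contDiff_radialPoint x
  have h1 : ContDiffOn ℝ 1 (fun z : (ℝ × ℝ) × EuclideanSpace ℝ (Fin 3) =>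
      fderivWithin ℝ u (tube x ρ T') (x + z.1.1 • z.2, z.1.2))
      {z | (x + z.1.1 • z.2, z.1.2) ∈ openTube x ρ T'} :=
    ((contDiffOn_fderivWithin_tube hρ hu).mono openTube_subset).comp hp.contDiffOn fun z hz => hz
  have h0 : ContDiffOn ℝ 1 (fun z : (ℝ × ℝ) × EuclideanSpace ℝ (Fin 3) =>
      u (x + z.1.1 • z.2, z.1.2)) {z | (x + z.1.1 • z.2, z.1.2) ∈ openTube x ρ T'} :=
    ((hu.of_le (by norm_num : (1 : WithTop ℕ∞) ≤ 2)).mono openTube_subset).comp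
      hp.contDiffOn fun z hz => hz
  unfold radialIntegrand
  exact (h0.smul contDiffOn_const).add ((by fun_prop : ContDiff ℝ 1 fun
    z : (ℝ × ℝ) × EuclideanSpace ℝ (Fin 3) => z.1.1).contDiffOn.smul (h1.clm_comp
      (contDiff_radialLift.comp contDiff_snd).contDiffOn))

/-- The derivative of `(r, t) ↦ radialMean (u (·, t)) x r`. -/
noncomputable def radialFDeriv (u : EuclideanSpace ℝ (Fin 3) × ℝ → ℝ)
    (x : EuclideanSpace ℝ (Fin 3)) (ρ : ℝ → ℝ) (T : ℝ) (v : ℝ × ℝ) : ℝ × ℝ →L[ℝ] ℝ :=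
  ∫ ω, radialIntegrand u (fderivWithin ℝ u (tube x ρ T)) x v ω ∂sphereMeasure 3

theorem radialFDeriv_apply (hρ : Continuous ρ) (hu : ContDiffOn ℝ 2 u (tube x ρ T'))
    {v : ℝ × ℝ} (hv : v ∈ radialTube ρ T') (w : ℝ × ℝ) :
    radialFDeriv u x ρ T' v w = ∫ ω, (u (x + v.1 • ω, v.2) * w.1 +
      v.1 * fderivWithin ℝ u (tube x ρ T') (x + v.1 • ω, v.2) (w.1 • ω, w.2))
        ∂sphereMeasure 3 := by
  have hi : Integrable (radialIntegrand u (fderivWithin ℝ u (tube x ρ T')) x v)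
      (sphereMeasure 3) :=
    (continuousOn_radialIntegrand hρ hu).integrable_slice (isCompact_sphere 0 1)
      ae_sphereMeasure_mem_sphere fun ω hω => mem_tube hv (by simpa using hω)
  rw [radialFDeriv, ContinuousLinearMap.integral_apply hi]
  simp only [radialIntegrand_apply]

theorem radialFDeriv_apply_radial (hρ : Continuous ρ) (hu : ContDiffOn ℝ 2 u (tube x ρ T'))
    {r t : ℝ} (hv : (r, t) ∈ radialTube ρ T') :
    radialFDeriv u x ρ T' (r, t) (1, 0) = radialMeanDeriv (fun y => u (y, t)) x r := by
  rw [radialFDeriv_apply hρ hu hv, radialMeanDeriv]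
  refine integral_congr_ae ?_
  filter_upwards [ae_sphereMeasure_mem_sphere (n := 3)] with ω hω
  rw [(hasFDerivAt_slice hρ hu (mem_tube hv (by simpa using hω))).fderiv]
  simp

theorem radialFDeriv_apply_time (hρ : Continuous ρ) (hu : ContDiffOn ℝ 2 u (tube x ρ T'))
    {r t : ℝ} (hv : (r, t) ∈ radialTube ρ T') :
    radialFDeriv u x ρ T' (r, t) (0, 1) =
      ∫ ω, r * fderivWithin ℝ u (tube x ρ T') (x + r • ω, t) (0, 1) ∂sphereMeasure 3 := by
  rw [radialFDeriv_apply hρ hu hv]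
  simp

theorem hasFDerivAt_radial (hρ : Continuous ρ) (hu : ContDiffOn ℝ 2 u (tube x ρ T'))
    {v : ℝ × ℝ} (hv : v ∈ radialTube ρ T') (h0 : 0 < v.2) :
    HasFDerivAt (fun v : ℝ × ℝ => radialMean (fun y => u (y, v.2)) x v.1)
      (radialFDeriv u x ρ T' v) v := by
  have hp := contDiff_radialPoint x
  have hO := (isOpen_openTube (x := x) (T' := T') hρ).preimage hp.continuous
  refine hasFDerivAt_integral_of_isCompact (isCompact_sphere 0 1) ae_sphereMeasure_mem_sphere hO
    (F := fun v ω => v.1 * u (x + v.1 • ω, v.2))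
    (F' := radialIntegrand u (fderivWithin ℝ u (tube x ρ T')) x) ?_
    (contDiffOn_radialIntegrand hρ hu).continuousOn ?_
    (fun ω hω => mem_openTube hv h0 (by simpa using hω))
  · exact (by fun_prop : Continuous fun
      z : (ℝ × ℝ) × EuclideanSpace ℝ (Fin 3) => z.1.1).continuousOn.mul
      ((hu.continuousOn.mono openTube_subset).comp hp.continuous.continuousOn fun z hz => hz)
  · rintro ⟨v, ω⟩ hz
    have hl : HasFDerivAt (fun v : ℝ × ℝ => (x + v.1 • ω, v.2)) (radialLift ω) v := by
      have := (radialLift ω).hasFDerivAt (x := v) |>.const_add ((x, 0) :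
        EuclideanSpace ℝ (Fin 3) × ℝ)
      simpa [radialLift_apply] using this
    have h1 := (hasFDerivAt_openTube hρ hu hz).comp v hl
    refine (hasFDerivAt_fst.mul h1).congr_fderiv ?_
    ext <;> simp [radialIntegrand, add_comm]

theorem hasFDerivAt_radialFDeriv (hρ : Continuous ρ) (hu : ContDiffOn ℝ 2 u (tube x ρ T'))
    {v : ℝ × ℝ} (hv : v ∈ radialTube ρ T') (h0 : 0 < v.2) :
    ∃ B : ℝ × ℝ →L[ℝ] ℝ × ℝ →L[ℝ] ℝ, HasFDerivAt (radialFDeriv u x ρ T') B v := by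
  have hp := contDiff_radialPoint x
  have hO := (isOpen_openTube (x := x) (T' := T') hρ).preimage hp.continuous
  have hC := contDiffOn_radialIntegrand hρ hu
  let H := fun z : (ℝ × ℝ) × EuclideanSpace ℝ (Fin 3) =>
        radialIntegrand u (fderivWithin ℝ u (tube x ρ T')) x z.1 z.2
  refine ⟨_, hasFDerivAt_integral_of_isCompact (isCompact_sphere 0 1)
    ae_sphereMeasure_mem_sphere hO
    (F := radialIntegrand u (fderivWithin ℝ u (tube x ρ T')) x)
    (F' := fun v ω => (fderiv ℝ H (v, ω)).comp (ContinuousLinearMap.inl ℝ _ _))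
    hC.continuousOn ?_ ?_ (fun ω hω => mem_openTube hv h0 (by simpa using hω))⟩
  · exact (hC.continuousOn_fderiv_of_isOpen hO le_rfl).clm_comp continuousOn_const
  · rintro ⟨v, ω⟩ hz
    have hH : HasFDerivAt H (fderiv ℝ H (v, ω)) (v, ω) :=
      ((hC.contDiffAt (hO.mem_nhds hz)).differentiableAt (by norm_num)).hasFDerivAt
    exact hH.comp (f := fun v => (v, ω)) v (hasFDerivAt_prodMk_left v ω)

theorem hasDerivAt_radialFDeriv_time (hρ : Continuous ρ) (hu : ContDiffOn ℝ 2 u (tube x ρ T'))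
    {r t : ℝ} (hv : (r, t) ∈ radialTube ρ T') (h0 : 0 < t) :
    HasDerivAt (fun s => radialFDeriv u x ρ T' (r, s) (0, 1))
      (∫ ω, r * fderiv ℝ (fderivWithin ℝ u (tube x ρ T')) (x + r • ω, t) (0, 1) (0, 1)
        ∂sphereMeasure 3) t := by
  have hp : Continuous fun z : ℝ × EuclideanSpace ℝ (Fin 3) => (x + r • z.2, z.1) := by fun_prop
  have hO := (isOpen_openTube (x := x) (T' := T') hρ).preimage hp
  have hC := (contDiffOn_fderivWithin_tube hρ hu).mono openTube_subset
  have h := hasDerivAt_integral_of_isCompact (μ := sphereMeasure 3) (isCompact_sphere 0 1)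
    ae_sphereMeasure_mem_sphere hO
    (F := fun s ω => r * fderivWithin ℝ u (tube x ρ T') (x + r • ω, s) (0, 1))
    (F' := fun s ω =>
      r * fderiv ℝ (fderivWithin ℝ u (tube x ρ T')) (x + r • ω, s) (0, 1) (0, 1))
    (s₀ := t) ?_ ?_ ?_ (fun ω hω => mem_openTube hv h0 (by simpa using hω))
  · refine h.congr_of_eventuallyEq ?_
    have hc : Continuous fun s : ℝ => (r, s) := by fun_prop
    filter_upwards [((isOpen_radialTube_base (T' := T') hρ).preimage hc).mem_nhds hv.1,
      lt_mem_nhds h0] with s h1 h2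
    exact radialFDeriv_apply_time hρ hu ⟨h1, h2.le⟩
  · exact continuousOn_const.mul ((hC.continuousOn.comp hp.continuousOn fun z hz => hz).clm_apply
      continuousOn_const)
  · exact continuousOn_const.mul ((((hC.continuousOn_fderiv_of_isOpen (isOpen_openTube hρ)
      le_rfl).comp hp.continuousOn fun z hz => hz).clm_apply
      continuousOn_const).clm_apply continuousOn_const)
  · rintro ⟨s, ω⟩ hz
    have h1 := (hasFDerivAt_fderivWithin_openTube hρ hu hz).comp_hasDerivAt s
      ((hasDerivAt_const s (x + r • ω)).prodMk (hasDerivAt_id' s))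
    refine ((h1.clm_apply (hasDerivAt_const s
      ((0, 1) : EuclideanSpace ℝ (Fin 3) × ℝ))).const_mul r).congr_deriv ?_
    simp

theorem eventually_mem_radialTube (hρ : Continuous ρ) {v : ℝ × ℝ} (hv : v ∈ radialTube ρ T')
    (h0 : 0 < v.2) : ∀ᶠ w in 𝓝 v, w ∈ radialTube ρ T' ∧ 0 < w.2 := by
  have h1 : ∀ᶠ w : ℝ × ℝ in 𝓝 v, 0 < w.2 := continuousAt_snd.eventually (lt_mem_nhds h0)
  filter_upwards [(isOpen_radialTube_base hρ).mem_nhds hv.1, h1] with w h1 h2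
  exact ⟨⟨h1, h2.le⟩, h2⟩

/-- Averaging commutes with the time derivatives, and Darboux's identity converts the averaged
Laplacian into the second r-derivative. -/
theorem isWaveSolution_radial (hρ : Continuous ρ) (hu : ContDiffOn ℝ 2 u (tube x ρ T'))
    (hT : T' ≤ T) :
    IsWaveSolution M (radialTube ρ T') (fun v => radialMean (fun y => u (y, v.2)) x v.1)
      (radialFDeriv u x ρ T')
      (fun v => radialMean (fun y => kleinGordon M T u (y, v.2)) x v.1) where
  continuousOn := by
    refine continuousOn_integral_of_isOpen_inter_isClosed (isCompact_sphere 0 1)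
      ae_sphereMeasure_mem_sphere (isOpen_radialTube_base hρ)
      (isClosed_le (by fun_prop) (by fun_prop))
      (F := fun v ω => v.1 * u (x + v.1 • ω, v.2)) ?_
    refine (by fun_prop : Continuous fun
      z : (ℝ × ℝ) × EuclideanSpace ℝ (Fin 3) => z.1.1).continuousOn.mul
      (hu.continuousOn.comp (contDiff_radialPoint x).continuous.continuousOn fun z hz => ?_)
    exact mem_tube hz.1 (by simpa using hz.2)
  continuousOn_deriv := by
    refine continuousOn_integral_of_isOpen_inter_isClosed (isCompact_sphere 0 1)
      ae_sphereMeasure_mem_sphere (isOpen_radialTube_base hρ)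
      (isClosed_le (by fun_prop) (by fun_prop)) ?_
    exact (continuousOn_radialIntegrand hρ hu).mono fun z hz =>
      mem_tube hz.1 (by simpa using hz.2)
  hasFDerivAt v hv h0 := hasFDerivAt_radial hρ hu hv h0
  wave := by
    rintro ⟨r, t⟩ hv h0
    obtain ⟨B, hB⟩ := hasFDerivAt_radialFDeriv hρ hu hv h0
    have hball : ∀ ω : EuclideanSpace ℝ (Fin 3), ‖ω‖ = 1 → x + r • ω ∈ ball x (ρ t) := fun ω hω =>
      SuperharmonicOn.add_smul_mem_ball hv.1.1 ω hω
    have hg := contDiffOn_slice hu (t := t) ⟨hv.2, hv.1.2⟩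
    have hev := eventually_mem_radialTube hρ hv h0
    -- The second derivative `B` is only known to exist; its diagonal entries are identified by
    -- uniqueness of derivatives along the coordinate lines.
    have hrr : B (1, 0) (1, 0) = r * ∫ ω, (Δ fun y => u (y, t)) (x + r • ω) ∂sphereMeasure 3 := by
      have d2 : HasDerivAt (fun s => radialFDeriv u x ρ T' (s, t) (1, 0)) _ r :=
        (hasDerivAt_radialMeanDeriv isOpen_ball hg hball).congr_of_eventuallyEq (by
          have hc : Tendsto (fun s : ℝ => (s, t)) (𝓝 r) (𝓝 (r, t)) :=
            (by fun_prop : Continuous fun s : ℝ => (s, t)).tendsto r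
          filter_upwards [hc.eventually hev] with s hs
          exact radialFDeriv_apply_radial hρ hu hs.1)
      exact (hasDerivAt_clm_fst hB (1, 0)).unique d2
    have htt : B (0, 1) (0, 1) =
        ∫ ω, r * fderiv ℝ (fderivWithin ℝ u (tube x ρ T')) (x + r • ω, t) (0, 1) (0, 1)
        ∂sphereMeasure 3 := by
      exact (hasDerivAt_clm_snd hB (0, 1)).unique (hasDerivAt_radialFDeriv_time hρ hu hv h0)
    refine ⟨B, hB, ?_, ?_⟩
    · refine second_derivative_symmetric_of_eventually (𝕜 := ℝ)
        (f := fun v : ℝ × ℝ => radialMean (fun y => u (y, v.2)) x v.1) ?_ hB _ _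
      filter_upwards [hev] with w hw using hasFDerivAt_radial hρ hu hw.1 hw.2
    · have hS : IsCompact (sphere (0 : EuclideanSpace ℝ (Fin 3)) 1) := isCompact_sphere 0 1
      have hμ := ae_sphereMeasure_mem_sphere (n := 3)
      have hpt : ContinuousOn (fun ω : EuclideanSpace ℝ (Fin 3) => (x + r • ω, t))
        (sphere 0 1) := by fun_prop
      have hpt' : ContinuousOn (fun ω : EuclideanSpace ℝ (Fin 3) => x + r • ω)
        (sphere 0 1) := by fun_prop
      have hmaps : MapsTo (fun ω : EuclideanSpace ℝ (Fin 3) => (x + r • ω, t)) (sphere 0 1)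
          (openTube x ρ T') := fun ω hω => mem_openTube hv h0 (by simpa using hω)
      have i1 : Integrable (fun ω => r * fderiv ℝ (fderivWithin ℝ u (tube x ρ T'))
          (x + r • ω, t) (0, 1) (0, 1)) (sphereMeasure 3) :=
        ContinuousOn.integrable_of_ae_mem_isCompact hS hμ (continuousOn_const.mul
          ((((((contDiffOn_fderivWithin_tube hρ hu).mono
            openTube_subset).continuousOn_fderiv_of_isOpen (isOpen_openTube hρ)
            le_rfl).comp hpt hmaps).clm_apply continuousOn_const).clm_apply continuousOn_const))
      have i2 : Integrable (fun ω => (Δ fun y => u (y, t)) (x + r • ω)) (sphereMeasure 3) :=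
        ContinuousOn.integrable_of_ae_mem_isCompact hS hμ
          ((continuousOn_laplacian isOpen_ball hg).comp hpt' fun ω hω =>
            hball ω (by simpa using hω))
      have i3 : Integrable (fun ω => r * u (x + r • ω, t)) (sphereMeasure 3) :=
        ContinuousOn.integrable_of_ae_mem_isCompact hS hμ (continuousOn_const.mul
          ((hu.continuousOn.mono openTube_subset).comp hpt hmaps))
      have hae : ∀ᵐ ω ∂sphereMeasure 3, r * kleinGordon M T u (x + r • ω, t) =
          r * fderiv ℝ (fderivWithin ℝ u (tube x ρ T')) (x + r • ω, t) (0, 1) (0, 1) -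
          Real.exp (-2 * t) * r * (Δ fun y => u (y, t)) (x + r • ω) -
          M ^ 2 * (r * u (x + r • ω, t)) := by
        filter_upwards [hμ] with ω hω
        rw [kleinGordon_eq hρ hu hT (hmaps hω)]
        ring
      simp only [radialMean]
      rw [integral_congr_ae hae, integral_sub _ (i3.const_mul _),
        integral_sub i1 (i2.const_mul _), integral_const_mul (M ^ 2),
        integral_const_mul (Real.exp (-2 * t) * r), hrr, htt]
      · ring
      · exact i1.sub (i2.const_mul _)

end DeSitter

/-! ### Comparison with the Duhamel bound -/

namespace DeSitter

variable {M T : ℝ} {D₀ : Set (EuclideanSpace ℝ (Fin 3))}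
  {u : EuclideanSpace ℝ (Fin 3) × ℝ → ℝ} {x : EuclideanSpace ℝ (Fin 3)}

/-- The bound is the value of the Duhamel formula with a continuous extension of the source. -/
theorem exists_continuous_duhamelBound_eq
    (hL : ContinuousOn (kleinGordon M T u) (dependenceSlab D₀ T)) {τ : ℝ} (hτ : τ ∈ Icc 0 T)
    (hx : (x, τ) ∈ dependenceDomain D₀) :
    ∃ h : ℝ → ℝ, Continuous h ∧ (∀ t ∈ Icc 0 τ, h t = kleinGordon M T u (x, t)) ∧
      ∀ t ∈ Icc 0 τ,
        duhamelBound M T u x t = duhamel M h (u (x, 0)) (initialVelocity T u x) t := by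
  have hc : ContinuousOn (fun b => kleinGordon M T u (x, b)) (Icc 0 τ) :=
    hL.comp (by fun_prop) fun b hb =>
      ⟨mem_dependenceDomain_of_le hb.1 hb.2 hx, hb.1, hb.2.trans hτ.2⟩
  refine ⟨IccExtend hτ.1 (domRestrict (Icc 0 τ) fun b => kleinGordon M T u (x, b)),
    hc.domRestrict.Icc_extend', fun t ht => ?_, fun t ht => ?_⟩
  · rw [IccExtend_of_mem hτ.1 _ ht, domRestrict_apply]
  · rw [duhamelBound, duhamel]
    congr 2
    refine intervalIntegral.integral_congr fun b hb => ?_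
    rw [uIcc_of_le ht.1] at hb
    rw [IccExtend_of_mem hτ.1 _ ⟨hb.1, hb.2.trans ht.2⟩, domRestrict_apply]

/-- Reduction to one space dimension: the difference `W` between `r` times the spherical mean of
`u` and `r` times the bound solves a one-dimensional equation with decreasing source. -/
theorem exists_isWaveSolution_mean_sub (hD₀ : IsOpen D₀)
    (hu : ContDiffOn ℝ 2 u (dependenceSlab D₀ T))
    (hLuC2 : ContDiffOn ℝ 2 (kleinGordon M T u) (dependenceSlab D₀ T))
    (hLuSuper : ∀ t ∈ Icc 0 T, SuperharmonicOn (fun x => kleinGordon M T u (x, t))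
      {x | (x, t) ∈ dependenceSlab D₀ T})
    {t₁ : ℝ} (ht₁ : t₁ ∈ Ioo 0 T) (hx : (x, t₁) ∈ dependenceDomain D₀) :
    ∃ ε > 0, ε ≤ 1 ∧ ball x (1 - Real.exp (-t₁) + ε) ⊆ D₀ ∧ ∃ W W' G,
      IsWaveSolution M {v | v.2 ∈ Icc 0 t₁ ∧ |v.1| < Real.exp (-v.2) - Real.exp (-t₁) + ε}
        W W' G ∧
      (∀ r t, W (-r, t) = -W (r, t)) ∧ (∀ t, G (0, t) = 0) ∧
      (∀ t ∈ Ioc 0 t₁, ∀ r s, |r| < Real.exp (-t) - Real.exp (-t₁) + ε →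
        |s| < Real.exp (-t) - Real.exp (-t₁) + ε → r ≤ s → G (s, t) ≤ G (r, t)) ∧
      (∀ r, |r| < 1 - Real.exp (-t₁) + ε →
        W (r, 0) = radialMean (fun y => u (y, 0)) x r - r * u (x, 0) ∧
        W' (r, 0) (1, 0) = radialMeanDeriv (fun y => u (y, 0)) x r - u (x, 0) ∧
        W' (r, 0) (0, 1) =
          radialMean (initialVelocity T u) x r - r * initialVelocity T u x) ∧
      ((∀ᶠ r in 𝓝[>] (0 : ℝ), W (r, t₁) ≤ 0) → u (x, t₁) ≤ duhamelBound M T u x t₁) := by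
  obtain ⟨ht0, htT⟩ := ht₁
  obtain ⟨ε, hε, hε1, hcone⟩ := exists_cone_subset_dependenceDomain hD₀ ht0.le hx
  set ρ : ℝ → ℝ := fun t => Real.exp (-t) - Real.exp (-t₁) + ε with hρdef
  have hρ : Continuous ρ := by fun_prop
  have hρ0 : ρ 0 = 1 - Real.exp (-t₁) + ε := by simp [hρdef]
  have hρpos : ∀ t ≤ t₁, 0 < ρ t := fun t ht => by
    have : Real.exp (-t₁) ≤ Real.exp (-t) := Real.exp_le_exp.2 (by linarith)
    simp only [hρdef]
    linarith
  have hsub : tube x ρ T ⊆ dependenceSlab D₀ T := fun p hp =>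
    ⟨hcone p.1 p.2 hp.2 hp.1.1, hp.2, hp.1.2.le⟩
  have hu' : ContDiffOn ℝ 2 u (tube x ρ T) := hu.mono hsub
  obtain ⟨h, hh, hheq, hbound⟩ := exists_continuous_duhamelBound_eq hLuC2.continuousOn
    ⟨ht0.le, htT.le⟩ hx
  have hΩ : {v : ℝ × ℝ | v.2 ∈ Icc 0 t₁ ∧ |v.1| < ρ v.2} ⊆ radialTube ρ T := fun v hv =>
    ⟨⟨hv.2, hv.1.2.trans_lt htT⟩, hv.1.1⟩
  have hU := (isWaveSolution_radial (M := M) hρ hu' le_rfl).mono hΩ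
  have hQ := isWaveSolution_duhamel (M := M) hh (u (x, 0)) (initialVelocity T u x)
    {v : ℝ × ℝ | v.2 ∈ Icc 0 t₁ ∧ |v.1| < ρ v.2}
  refine ⟨ε, hε, hε1, fun y hy => ?_, _, _, _, hU.sub hQ, fun r t => ?_, fun t => ?_,
    fun t ht r s hr hs hrs => ?_, fun r hr => ⟨?_, ?_, ?_⟩, fun hW => ?_⟩
  · have := hcone y 0 le_rfl (by simpa [dist_eq_norm] using hy)
    rw [mem_dependenceDomain_iff le_rfl] at this
    exact this (by simp)
  · simp only [radialMean_neg]; ring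
  · simp [radialMean_zero]
  · have hf : SuperharmonicOn (fun y => kleinGordon M T u (y, t)) (ball x (ρ t)) :=
      (hLuSuper t ⟨ht.1.le, ht.2.trans htT.le⟩).mono fun y hy =>
        hsub ⟨⟨by simpa [dist_eq_norm] using hy, ht.2.trans_lt htT⟩, ht.1.le⟩
    have := hf.radialMean_sub_le hr hs hrs
    simp only [hheq t ⟨ht.1.le, ht.2⟩]
    linarith
  · simp [duhamel, sinhOver_zero]
  · rw [_root_.sub_apply, radialFDeriv_apply_radial hρ hu'
      (hΩ ⟨⟨le_rfl, ht0.le⟩, by simpa [hρdef] using hr⟩)]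
    simp [duhamel, sinhOver_zero]
  · have hv : (r, (0 : ℝ)) ∈ radialTube ρ T := hΩ ⟨⟨le_rfl, ht0.le⟩, by simpa [hρdef] using hr⟩
    rw [_root_.sub_apply, radialFDeriv_apply_time hρ hu' hv]
    congr 1
    · refine integral_congr_ae ?_
      filter_upwards [ae_sphereMeasure_mem_sphere (n := 3)] with ω hω
      rw [initialVelocity,
        derivWithin_time hρ hu' le_rfl (mem_tube hv (mem_sphere_zero_iff_norm.1 hω))]
    · simp [duhamelDeriv, sinhOver_zero]
  · have hg := contDiffOn_slice hu' (t := t₁) ⟨ht0.le, htT⟩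
    -- The value u(x,t₁) is the r-derivative of r times the spherical mean at r = 0, hence the limit
    -- of difference quotients, which W ≤ 0 bounds by Q(t₁).
    have hd := hasDerivAt_radialMean (x := x) (r := 0) isOpen_ball hg
      (fun ω _ => by simpa using hρpos t₁ le_rfl)
    rw [radialMeanDeriv_zero] at hd
    have hslope := (hasDerivWithinAt_iff_tendsto_slope' self_notMem_Ioi).1
      (hd.hasDerivWithinAt (s := Ioi 0))
    rw [hbound t₁ ⟨ht0.le, le_rfl⟩]
    refine le_of_tendsto hslope ?_
    filter_upwards [hW, self_mem_nhdsWithin] with r h1 (h2 : 0 < r)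
    rw [slope_def_field, radialMean_zero, sub_zero, sub_zero, div_le_iff₀ h2]
    linarith

/-- The comparison for `M ≥ 1 / 2`. -/
theorem le_duhamelBound_of_half_le (hM : 1 / 2 ≤ M) (hD₀ : IsOpen D₀)
    (hu : ContDiffOn ℝ 2 u (dependenceSlab D₀ T))
    (hLuC2 : ContDiffOn ℝ 2 (kleinGordon M T u) (dependenceSlab D₀ T))
    (hLuSuper : ∀ t ∈ Icc 0 T, SuperharmonicOn (fun x => kleinGordon M T u (x, t))
      {x | (x, t) ∈ dependenceSlab D₀ T})
    (hu₀Super : SuperharmonicOn (fun x => u (x, 0)) D₀)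
    (hu₁Super : SuperharmonicOn (initialVelocity T u) D₀)
    {t₁ : ℝ} (ht₁ : t₁ ∈ Ioo 0 T) (hx : (x, t₁) ∈ dependenceDomain D₀) :
    u (x, t₁) ≤ duhamelBound M T u x t₁ := by
  obtain ⟨ε, hε, hε1, hball, W, W', G, hW, hodd, hG0, hG, hinit, hconcl⟩ :=
    exists_isWaveSolution_mean_sub hD₀ hu hLuC2 hLuSuper ht₁ hx
  have hexp := Real.exp_pos (-t₁)
  have h0 := hu₀Super.mono hball
  have h1 := hu₁Super.mono hball
  -- Halving `ε` fits a closed region, on which maxima exist, into the open one, and still leaves an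
  -- interval of positive r at time t₁.
  have hK := hW.mono (Ω := {v | v.2 ∈ Icc 0 t₁ ∧
    v.1 ∈ Icc 0 (Real.exp (-v.2) - Real.exp (-t₁) + ε / 2)}) fun v hv => by
      refine ⟨hv.1, ?_⟩
      rw [abs_of_nonneg hv.2.1]
      linarith [hv.2.2]
  refine hconcl ?_
  filter_upwards [Ioo_mem_nhdsGT (half_pos hε)] with r hr
  refine IsWaveSolution.nonpos_of_half_line hM hK (fun r t ht hr => ?_) (fun t _ => ?_)
    (fun r hr => ?_) (fun r hr => ?_) ⟨ht₁.1.le, le_rfl⟩ ⟨hr.1.le, by linarith [hr.2]⟩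
  · rw [← hG0 t]
    refine hG t ht 0 r ?_ ?_ hr.1
    · rw [abs_zero]; linarith [hr.1, hr.2]
    · rw [abs_of_nonneg hr.1]; linarith [hr.2]
  · have := hodd 0 t
    rw [neg_zero] at this
    linarith
  · have hr' : r < 1 - Real.exp (-t₁) + ε := by linarith [hr.2]
    rw [(hinit r (by rwa [abs_of_nonneg hr.1])).1]
    linarith [h0.radialMean_le hr.1 hr']
  · have hr' : r < 1 - Real.exp (-t₁) + ε := by linarith [hr.2]
    have habs : |r| < 1 - Real.exp (-t₁) + ε := by rwa [abs_of_nonneg hr.1]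
    obtain ⟨e1, e2, e3⟩ := hinit r habs
    rw [e1, e2, e3]
    have a1 := h0.radialMeanDeriv_le habs
    have a2 := h0.mul_radialMeanDeriv_le hr.1 hr'
    have a3 := h1.radialMean_le hr.1 hr'
    -- Let m be the initial `radialMean`. By r m' ≤ m, the position part (m' - u) - (m - ru)/2 is at
    -- most (m' - u)(1 - r/2), and r ≤ 2 because ε ≤ 1.
    have a4 : (radialMeanDeriv (fun y => u (y, 0)) x r - u (x, 0)) * (1 - r / 2) ≤ 0 :=
      mul_nonpos_of_nonpos_of_nonneg (by linarith) (by linarith)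
    linarith

/-- The comparison for vanishing initial position. -/
theorem le_duhamelBound_of_initial_eq_zero (hD₀ : IsOpen D₀)
    (hu : ContDiffOn ℝ 2 u (dependenceSlab D₀ T))
    (hLuC2 : ContDiffOn ℝ 2 (kleinGordon M T u) (dependenceSlab D₀ T))
    (hLuSuper : ∀ t ∈ Icc 0 T, SuperharmonicOn (fun x => kleinGordon M T u (x, t))
      {x | (x, t) ∈ dependenceSlab D₀ T})
    (hu₀ : ∀ x ∈ D₀, u (x, 0) = 0)
    (hu₁Super : SuperharmonicOn (initialVelocity T u) D₀)
    {t₁ : ℝ} (ht₁ : t₁ ∈ Ioo 0 T) (hx : (x, t₁) ∈ dependenceDomain D₀) :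
    u (x, t₁) ≤ duhamelBound M T u x t₁ := by
  obtain ⟨ε, hε, hε1, hball, W, W', G, hW, hodd, hG0, hG, hinit, hconcl⟩ :=
    exists_isWaveSolution_mean_sub hD₀ hu hLuC2 hLuSuper ht₁ hx
  have hexp1 : Real.exp (-t₁) ≤ 1 := Real.exp_le_one_iff.2 (by linarith [ht₁.1])
  have h1 := hu₁Super.mono hball
  have hx0 : u (x, 0) = 0 := hu₀ x (hball (mem_ball_self (by linarith)))
  have hmean : ∀ r, |r| < 1 - Real.exp (-t₁) + ε →
      radialMean (fun y => u (y, 0)) x r = 0 ∧ radialMeanDeriv (fun y => u (y, 0)) x r = 0 := by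
    intro r hr
    have hae := ae_sphereMeasure_mem_sphere (n := 3)
    constructor
    · refine integral_eq_zero_of_ae ?_
      filter_upwards [hae] with ω hω
      have := hu₀ _ (hball (SuperharmonicOn.add_smul_mem_ball hr ω
        (mem_sphere_zero_iff_norm.1 hω)))
      simp [this]
    · refine integral_eq_zero_of_ae ?_
      filter_upwards [hae] with ω hω
      have hm := hball (SuperharmonicOn.add_smul_mem_ball (x := x) hr ω
        (mem_sphere_zero_iff_norm.1 hω))
      have hev : (fun y => u (y, 0)) =ᶠ[𝓝 (x + r • ω)] fun _ => 0 := by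
        filter_upwards [hD₀.mem_nhds hm] with y hy using hu₀ y hy
      rw [hev.fderiv_eq, hu₀ _ hm]
      simp
  refine hconcl ?_
  filter_upwards [Ioo_mem_nhdsGT hε] with h hh
  have hshift : ∀ {r a : ℝ}, |r| ≤ a → |r + h| < a + ε ∧ |r + -h| < a + ε := fun {r a} hr => by
    have hr := abs_le.1 hr
    exact ⟨abs_lt.2 ⟨by linarith [hh.1, hh.2], by linarith [hh.1, hh.2]⟩,
      abs_lt.2 ⟨by linarith [hh.1, hh.2], by linarith [hh.1, hh.2]⟩⟩
  -- The symmetric difference W(r+h,t) - W(r-h,t) has a nonpositive source without any sign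
  -- condition on r; h < ε keeps both shifts inside the region of W.
  have hdiff := (hW.translate (Ω := {v | v.2 ∈ Icc 0 t₁ ∧
      |v.1| ≤ Real.exp (-v.2) - Real.exp (-t₁)}) h fun v hv =>
        ⟨by simpa using hv.1, by simpa using (hshift hv.2).1⟩).sub
    (hW.translate (-h) fun v hv => ⟨by simpa using hv.1, by simpa using (hshift hv.2).2⟩)
  have key := IsWaveSolution.nonpos_of_whole_line hdiff (fun r t ht hr => ?_) (fun r hr => ?_)
    (fun r hr => ?_) (r := 0) (t := t₁) ⟨ht₁.1.le, le_rfl⟩ (by simp)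
  · simp only [Prod.mk_add_mk, zero_add, add_zero] at key
    linarith [hodd h t₁]
  · have := hG t ht (r + -h) (r + h) (hshift hr).2 (hshift hr).1 (by linarith [hh.1])
    simp only [Prod.mk_add_mk, add_zero]
    linarith
  · simp only [Prod.mk_add_mk, add_zero]
    rw [(hinit _ (hshift hr).1).1, (hinit _ (hshift hr).2).1, (hmean _ (hshift hr).1).1,
      (hmean _ (hshift hr).2).1, hx0]
    simp
  · obtain ⟨-, e2, e3⟩ := hinit _ (hshift hr).1
    obtain ⟨-, f2, f3⟩ := hinit _ (hshift hr).2
    simp only [Prod.mk_add_mk, add_zero, _root_.sub_apply]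
    rw [e2, e3, f2, f3, (hmean _ (hshift hr).1).2, (hmean _ (hshift hr).2).2]
    have := h1.radialMean_sub_le (hshift hr).2 (hshift hr).1 (by linarith [hh.1])
    simp only [sub_self, abs_zero, add_zero]
    linarith

theorem duhamelBound_zero : duhamelBound M T u x 0 = u (x, 0) := by
  simp [duhamelBound, sinhOver_zero]

theorem duhamelBound_nonpos (hM : 0 ≤ M) {t : ℝ} (ht : t ∈ Icc 0 T)
    (hLu : ∀ p ∈ dependenceSlab D₀ T, kleinGordon M T u p ≤ 0)
    (hu₀ : ∀ x ∈ D₀, u (x, 0) ≤ 0) (hu₁ : ∀ x ∈ D₀, initialVelocity T u x ≤ 0)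
    (hx : (x, t) ∈ dependenceDomain D₀) : duhamelBound M T u x t ≤ 0 := by
  have hxD : x ∈ D₀ := by
    have := mem_dependenceDomain_of_le le_rfl ht.1 hx
    rw [mem_dependenceDomain_iff le_rfl] at this
    exact this (by simp)
  have h1 : ∫ b in (0 : ℝ)..t, kleinGordon M T u (x, b) * sinhOver M (t - b) ≤ 0 := by
    rw [← neg_nonneg, ← intervalIntegral.integral_neg]
    refine intervalIntegral.integral_nonneg ht.1 fun b hb => ?_
    rw [neg_nonneg]
    exact mul_nonpos_of_nonpos_of_nonneg
      (hLu _ ⟨mem_dependenceDomain_of_le hb.1 hb.2 hx, hb.1, hb.2.trans ht.2⟩)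
      (sinhOver_nonneg hM (by linarith [hb.2]))
  have h2 := mul_nonpos_of_nonneg_of_nonpos (Real.cosh_pos (M * t)).le (hu₀ x hxD)
  have h3 := mul_nonpos_of_nonneg_of_nonpos (sinhOver_nonneg hM ht.1) (hu₁ x hxD)
  rw [duhamelBound]
  linarith

/-- The bound on `(0, T)` extends to `[0, T]` by continuity. -/
theorem le_duhamelBound_of_forall_Ioo (hu : ContinuousOn u (dependenceSlab D₀ T))
    (hL : ContinuousOn (kleinGordon M T u) (dependenceSlab D₀ T)) {t : ℝ} (ht : t ∈ Icc 0 T)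
    (hT : 0 < T) (hx : (x, t) ∈ dependenceDomain D₀)
    (h : ∀ s ∈ Ioo 0 T, (x, s) ∈ dependenceDomain D₀ → u (x, s) ≤ duhamelBound M T u x s) :
    u (x, t) ≤ duhamelBound M T u x t := by
  rcases ht.1.eq_or_lt with rfl | h0
  · exact duhamelBound_zero.ge
  rcases ht.2.eq_or_lt with rfl | hlt
  -- At the final time t = T both sides are limits from the left, the bound being continuous through
  -- the extended source.
  · obtain ⟨g, hg, -, hgeq⟩ := exists_continuous_duhamelBound_eq hL ht hx
    have hmaps : MapsTo (fun s : ℝ => (x, s)) (Icc 0 t) (dependenceSlab D₀ t) := fun s hs =>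
      ⟨mem_dependenceDomain_of_le hs.1 hs.2 hx, hs⟩
    have hcu : ContinuousOn (fun s => u (x, s)) (Icc 0 t) := hu.comp (by fun_prop) hmaps
    rw [hgeq t ht]
    have hIoo : Ioo 0 t ⊆ Icc 0 t := Ioo_subset_Icc_self
    have hne : (𝓝[Ioo 0 t] t).NeBot := right_nhdsWithin_Ioo_neBot h0
    refine le_of_tendsto_of_tendsto ((hcu t ht).mono hIoo)
      ((continuous_duhamel hg _ _).continuousAt.tendsto.mono_left nhdsWithin_le_nhds) ?_
    filter_upwards [self_mem_nhdsWithin] with s hs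
    rw [← hgeq s (hIoo hs)]
    exact h s hs (mem_dependenceDomain_of_le hs.1.le hs.2.le hx)
  · exact h t ⟨h0, hlt⟩ hx

end DeSitter

theorem theorem2 (M T : ℝ) (hM : 0 ≤ M) (hT : 0 < T)
    (D₀ : Set (EuclideanSpace ℝ (Fin 3))) (hD₀ : IsOpen D₀)
    (u : EuclideanSpace ℝ (Fin 3) × ℝ → ℝ)
    (hu : ContDiffOn ℝ 2 u (DeSitter.dependenceSlab D₀ T))
    (hLu : ∀ p ∈ DeSitter.dependenceSlab D₀ T, DeSitter.kleinGordon M T u p ≤ 0)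
    (hLuC2 : ContDiffOn ℝ 2 (DeSitter.kleinGordon M T u) (DeSitter.dependenceSlab D₀ T))
    (hLuSuper : ∀ t ∈ Set.Icc 0 T,
      DeSitter.SuperharmonicOn (fun x => DeSitter.kleinGordon M T u (x, t))
        {x | (x, t) ∈ DeSitter.dependenceSlab D₀ T})
    (hu₀Super : DeSitter.SuperharmonicOn (fun x => u (x, 0)) D₀)
    (hu₀ : ∀ x ∈ D₀, u (x, 0) ≤ 0)
    (hu₁Super : DeSitter.SuperharmonicOn (DeSitter.initialVelocity T u) D₀)
    (hu₁ : ∀ x ∈ D₀, DeSitter.initialVelocity T u x ≤ 0) :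
    (1 < M → ∀ x t, (x, t) ∈ DeSitter.dependenceDomain D₀ →
      t ∈ Set.Icc (Real.log (M / (M - 1))) T →
        u (x, t) ≤ DeSitter.duhamelBound M T u x t ∧ u (x, t) ≤ 0) ∧
    ((∀ x ∈ D₀, u (x, 0) = 0) → ∀ x t, (x, t) ∈ DeSitter.dependenceDomain D₀ →
      t ∈ Set.Icc 0 T →
        u (x, t) ≤ DeSitter.duhamelBound M T u x t ∧ u (x, t) ≤ 0) := by
  have hfinish : (∀ x, ∀ t ∈ Ioo 0 T, (x, t) ∈ DeSitter.dependenceDomain D₀ →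
      u (x, t) ≤ DeSitter.duhamelBound M T u x t) →
      ∀ x t, (x, t) ∈ DeSitter.dependenceDomain D₀ → t ∈ Icc 0 T →
        u (x, t) ≤ DeSitter.duhamelBound M T u x t ∧ u (x, t) ≤ 0 := fun h x t hx ht => by
    have hle := DeSitter.le_duhamelBound_of_forall_Ioo hu.continuousOn hLuC2.continuousOn ht hT hx
      (h x)
    exact ⟨hle, hle.trans (DeSitter.duhamelBound_nonpos hM ht hLu hu₀ hu₁ hx)⟩
  refine ⟨fun hM1 x t hx ht => ?_, fun h0 => ?_⟩
  -- Since M/(M-1) ≥ 1, the times considered are nonnegative, and M > 1 lies in the range of the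
  -- half-line comparison.
  · refine hfinish (fun x t ht hx => ?_) x t hx ⟨le_trans (Real.log_nonneg ?_) ht.1, ht.2⟩
    · exact DeSitter.le_duhamelBound_of_half_le (by linarith) hD₀ hu hLuC2 hLuSuper hu₀Super
        hu₁Super ht hx
    · rw [le_div_iff₀ (by linarith)]
      linarith
  · exact hfinish fun x t ht hx => DeSitter.le_duhamelBound_of_initial_eq_zero hD₀ hu hLuC2
      hLuSuper h0 hu₁Super ht hx
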